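/- Let $q$ be a complex number with $0<|q|<1$. Put $(a;q)_\infty=\prod_{k\ge 0}(1-aq^k)$, $(a;q)_n=\prod_{k=0}^{n-1}(1-aq^k)$, $(a_1,\dots,a_m;q)_n=(a_1;q)_n\cdots(a_m;q)_n$ for $n\in\mathbb N\cup\{\infty\}$, and $${}_r\phi_s\left[\begin{matrix}a_1,\dots,a_r\\ b_1,\dots,b_s\end{matrix};q,z\right]=\sum_{k=0}^\infty\frac{(a_1,\dots,a_r;q)_k}{(b_1,\dots,b_s;q)_k}\,\frac{z^k}{(q;q)_k}\Bigl((-1)^kq^{\binom k2}\Bigr)^{s-r+1}.$$ (1) Let $a,b,c,d,e\in\mathbb C$ with $a,b,c,e\neq0$ and $|de/abc|<1$, and suppose that none of $d,\ e,\ de/bc,\ e/bc,\ bc/e$ is of the form $q^{-k}$ with $k\in\mathbb N=\{0,1,2,\dots\}$ (so that no denominator below vanishes). Then the three series below converge absolutely and $${}_3\phi_2\left[\begin{matrix}a,b,c\\ d,e\end{matrix};q,\frac{de}{abc}\right]=\frac{(e/b,e/c;q)_\infty}{(e,e/bc;q)_\infty}\,{}_3\phi_2\left[\begin{matrix}d/a,b,c\\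 d,bcq/e\end{matrix};q,q\right]+\frac{(d/a,b,c,de/bc;q)_\infty}{(d,e,bc/e,de/abc;q)_\infty}\,{}_3\phi_2\left[\begin{matrix}e/b,e/c,de/abc\\ de/bc,eq/bc\end{matrix};q,q\right].$$ (2) Let $a,b,c,d,e,f\in\mathbb C$ be nonzero with $|a^2q^2/bcdef|<1$, let $a^{1/2}$ be either square root of $a$, and suppose that none of $a^{1/2},\ -a^{1/2},\ aq/b,\ aq/c,\ aq/d,\ aq/e,\ aq/f,\ a^2q^2/bdef,\ a^2q^2/cdef,\ aq/def,\ def/(aq)$ is of the form $q^{-k}$ with $k\in\mathbb N$. Then the three series below converge absolutely and $$\begin{aligned}&{}_8\phi_7\left[\begin{matrix}a,qa^{1/2},-qa^{1/2},b,c,d,e,f\\ a^{1/2},-a^{1/2},aq/b,aq/c,aq/d,aq/e,aq/f\end{matrix};q,\frac{a^2q^2}{bcdef}\right]\\&=\frac{(aq,aq/de,aq/df,aq/ef;q)_\infty}{(aq/d,aq/e,aq/f,aq/def;q)_\infty}\,{}_4\phi_3\left[\begin{matrix}aq/bc,d,e,f\\ aq/b,aq/c,def/a\end{matrix};q,q\right]\\&\quad+\frac{(aq,aq/bc,d,e,f,a^2q^2/bdef,a^2q^2/cdef;q)_\infty}{(aq/b,aq/c,aq/d,aq/e,aq/f,a^2q^2/bcdef,def/(aq);q)_\infty}\,{}_4\phi_3\left[\begin{matrix}aq/de,aq/df,aq/ef,a^2q^2/bcdef\\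 a^2q^2/bdef,a^2q^2/cdef,aq^2/def\end{matrix};q,q\right].\end{aligned}$$ -/

import Mathlib

/-- The finite `q`-shifted factorial `(a;q)_n = ∏_{k<n} (1 - a q^k)`, for `n ∈ ℕ`. -/
def qPoch (a q : ℂ) (n : ℕ) : ℂ := ∏ k ∈ Finset.range n, (1 - a * q ^ k)

/-- The infinite `q`-shifted factorial `(a;q)_∞ = ∏_{k≥0} (1 - a q^k)`. -/
noncomputable def qPochInf (a q : ℂ) : ℂ := ∏' k : ℕ, (1 - a * q ^ k)

/-- The product `(a_1,…,a_m;q)_n`. -/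
noncomputable def qPochList (as : List ℂ) (q : ℂ) (n : ℕ) : ℂ :=
  (as.map fun a => qPoch a q n).prod

/-- The product `(a_1,…,a_m;q)_∞`. -/
noncomputable def qPochInfList (as : List ℂ) (q : ℂ) : ℂ :=
  (as.map fun a => qPochInf a q).prod

/-- The `k`-th term of the basic hypergeometric series `_rφ_s[a_1,…,a_r; b_1,…,b_s; q, z]`. -/
noncomputable def qHypTerm (as bs : List ℂ) (q z : ℂ) (k : ℕ) : ℂ :=
  qPochList as q k / qPochList bs q k * (z ^ k / qPoch q q k) *
    ((-1) ^ k * q ^ (k.choose 2)) ^ ((bs.length : ℤ) - (as.length : ℤ) + 1)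

/-- The basic hypergeometric series `_rφ_s[a_1,…,a_r; b_1,…,b_s; q, z]`. -/
noncomputable def qHyp (as bs : List ℂ) (q z : ℂ) : ℂ := ∑' k : ℕ, qHypTerm as bs q z k

/-- For `|q| < 1` the product defining `(a;q)_∞` converges. -/
theorem multipliable_qPochInf (a q : ℂ) (hq : ‖q‖ < 1) :
    Multipliable fun k : ℕ => (1 - a * q ^ k) := by
  have h : Summable fun k : ℕ => ‖-(a * q ^ k)‖ := by
    simp only [norm_neg, norm_mul, norm_pow]
    exact (summable_geometric_of_lt_one (norm_nonneg q) hq).mul_left _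
  simpa [sub_eq_add_neg] using multipliable_one_add_of_summable h

/-- The relation `(a;q)_n = (a;q)_∞ / (a q^n;q)_∞`, written without division. -/
theorem qPoch_mul_qPochInf (a q : ℂ) (hq : ‖q‖ < 1) (n : ℕ) :
    qPoch a q n * qPochInf (a * q ^ n) q = qPochInf a q := by
  have h : Multipliable fun k : ℕ => (1 - a * q ^ (k + n)) := by
    have := multipliable_qPochInf (a * q ^ n) q hq
    refine this.congr fun k => ?_
    ring
  have h2 := Multipliable.prod_mul_tprod_nat_mul' (f := fun k : ℕ => (1 - a * q ^ k)) h
  unfold qPoch qPochInf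
  rw [← h2]
  congr 1
  refine tprod_congr fun k => ?_
  ring

/-! Both parts are instances of one identity, `tsum_wellPoisedTerm`, which rests on two summations.
The first is the nonterminating `q`-Saalschütz formula `saalSum_eq`. Replacing `a` by `aq` in either
of its two series gives a difference that telescopes. The limits of the two telescoped sums cancel
in the combination, so `saalSum` obeys a homogeneous first-order recurrence. Iterating it sends the
parameter to 0 and produces the infinite products; doing this for each parameter leaves a constant,
read off at `a = 1`, `b = c = 0`. The second is Rogers' very-well-poised sum `tsum_rogersTerm`. Its
recurrence under `δ ↦ δq` also telescopes, with no limit term. Starting from `δ = 1` it evaluates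
the terminating cases `δ = q ^ N`; `N → ∞` gives the value at `δ = 0`; iterating from a general `δ`
down to 0 gives the rest. For the transformation, let `aq = defx`. The quotient of factorials in `d,
e, f` in the `k`-th term of the very-well-poised series is, up to constants, the right side of the
`q`-Saalschütz formula at `dq^k, eq^k, fq^k, x/q^k`. Each term thus splits into two series
(`wellPoisedTerm_mul`). In the first double series, collecting `k + n = N` leaves a terminating
Rogers sum with `δ = q ^ N`; in the second, exchanging the sums leaves a Rogers sum with `δ = x q ^
j`. Part (2) is the case `x = aq/def`. Part (1) is the degenerate case in which `a` and `d` vanish.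
Writing the parameters as `B = aq/b`, `γ = 1/c`, `δ = 1/d` keeps such limits inside the formulas. -/

open Filter Topology

/-! ### Finite and infinite `q`-shifted factorials -/

theorem qPoch_zero (x q : ℂ) : qPoch x q 0 = 1 := by simp [qPoch]

theorem qPoch_succ (x q : ℂ) (n : ℕ) : qPoch x q (n + 1) = qPoch x q n * (1 - x * q ^ n) := by
  simp [qPoch, Finset.prod_range_succ]

theorem qPoch_one (x q : ℂ) : qPoch x q 1 = 1 - x := by simp [qPoch]

theorem qPoch_add (x q : ℂ) (m n : ℕ) :
    qPoch x q (m + n) = qPoch x q m * qPoch (x * q ^ m) q n := by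
  simp only [qPoch, Finset.prod_range_add, pow_add, mul_assoc]

theorem qPoch_succ_left (x q : ℂ) (n : ℕ) :
    qPoch x q (n + 1) = (1 - x) * qPoch (x * q) q n := by
  rw [add_comm, qPoch_add, qPoch_one, pow_one]

theorem qPoch_zero_left (q : ℂ) (n : ℕ) : qPoch 0 q n = 1 := by simp [qPoch]

theorem qPochInf_zero_left (q : ℂ) : qPochInf 0 q = 1 := by simp [qPochInf]

theorem qPoch_ne_zero {x q : ℂ} (h : ∀ k : ℕ, x * q ^ k ≠ 1) (n : ℕ) : qPoch x q n ≠ 0 :=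
  Finset.prod_ne_zero_iff.2 fun k _ => sub_ne_zero.2 (h k).symm

theorem mul_pow_ne_one_shift {x q : ℂ} (h : ∀ k : ℕ, x * q ^ k ≠ 1) (m k : ℕ) :
    x * q ^ m * q ^ k ≠ 1 := by
  rw [mul_assoc, ← pow_add]; exact h _

theorem mul_pow_ne_one_of_norm_lt {x q : ℂ} (hq : ‖q‖ < 1) (hx : ‖x‖ < 1) (k : ℕ) :
    x * q ^ k ≠ 1 := by
  intro h
  have h1 : ‖x * q ^ k‖ = 1 := by rw [h, norm_one]
  rw [norm_mul, norm_pow] at h1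
  have : ‖q‖ ^ k ≤ 1 := pow_le_one₀ (norm_nonneg _) hq.le
  nlinarith [norm_nonneg x, norm_nonneg q]

theorem qPochInf_ne_zero {x q : ℂ} (hq : ‖q‖ < 1) (h : ∀ k : ℕ, x * q ^ k ≠ 1) :
    qPochInf x q ≠ 0 := by
  have hs : Summable fun k : ℕ => ‖-(x * q ^ k)‖ := by
    simp only [norm_neg, norm_mul, norm_pow]
    exact (summable_geometric_of_lt_one (norm_nonneg q) hq).mul_left _
  have := tprod_one_add_ne_zero_of_summable (f := fun k : ℕ => -(x * q ^ k))
    (fun k => by rw [← sub_eq_add_neg]; exact sub_ne_zero.2 (h k).symm) hs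
  simpa [qPochInf, sub_eq_add_neg] using this

theorem qPochInf_eq_mul {q : ℂ} (hq : ‖q‖ < 1) (x : ℂ) :
    qPochInf x q = (1 - x) * qPochInf (x * q) q := by
  have := qPoch_mul_qPochInf x q hq 1
  rw [qPoch_one, pow_one] at this
  exact this.symm

theorem qPochInf_one_left {q : ℂ} (hq : ‖q‖ < 1) : qPochInf 1 q = 0 := by
  rw [qPochInf_eq_mul hq]; simp

theorem tendsto_qPoch {q : ℂ} (hq : ‖q‖ < 1) (x : ℂ) :
    Tendsto (qPoch x q) atTop (𝓝 (qPochInf x q)) :=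
  (multipliable_qPochInf x q hq).hasProd.tendsto_prod_nat

theorem tendsto_mul_pow {q : ℂ} (hq : ‖q‖ < 1) (x : ℂ) :
    Tendsto (fun m : ℕ => x * q ^ m) atTop (𝓝 0) := by
  simpa using (tendsto_pow_atTop_nhds_zero_of_norm_lt_one hq).const_mul x

theorem tendsto_qPochInf_mul_pow {q : ℂ} (hq : ‖q‖ < 1) (x : ℂ) :
    Tendsto (fun m : ℕ => qPochInf (x * q ^ m) q) atTop (𝓝 1) := by
  -- Beyond such an `M` no factor vanishes, so the tail product is a quotient of the full product by
  -- its partial products.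
  obtain ⟨M, hM⟩ : ∃ M : ℕ, ‖x * q ^ M‖ < 1 := by
    have := (tendsto_mul_pow hq x).norm
    rw [norm_zero] at this
    exact (this.eventually (gt_mem_nhds one_pos)).exists
  have hne := mul_pow_ne_one_of_norm_lt hq hM
  have h0 := qPochInf_ne_zero hq hne
  have h1 : Tendsto (fun m => qPochInf (x * q ^ M) q / qPoch (x * q ^ M) q m) atTop
      (𝓝 (qPochInf (x * q ^ M) q / qPochInf (x * q ^ M) q)) :=
    tendsto_const_nhds.div (tendsto_qPoch hq _) h0
  rw [div_self h0] at h1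
  refine (tendsto_add_atTop_iff_nat M).1 (h1.congr fun m => ?_)
  rw [div_eq_iff (qPoch_ne_zero hne m), ← qPoch_mul_qPochInf (x * q ^ M) q hq m, mul_assoc x,
    ← pow_add, add_comm M]
  ring

/-! ### Bounded families -/

/-- A family of complex numbers that is bounded in norm. -/
def NormBdd {ι : Type*} (f : ι → ℂ) : Prop := ∃ C : ℝ, ∀ i, ‖f i‖ ≤ C

namespace NormBdd

variable {ι : Type*} {f g : ι → ℂ}

theorem const (c : ℂ) : NormBdd fun _ : ι => c := ⟨‖c‖, fun _ => le_rfl⟩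

theorem mul (hf : NormBdd f) (hg : NormBdd g) : NormBdd fun i => f i * g i := by
  obtain ⟨C, hC⟩ := hf
  obtain ⟨D, hD⟩ := hg
  refine ⟨C * D, fun i => ?_⟩
  rw [norm_mul]
  exact mul_le_mul (hC i) (hD i) (norm_nonneg _) ((norm_nonneg _).trans (hC i))

theorem sub (hf : NormBdd f) (hg : NormBdd g) : NormBdd fun i => f i - g i := by
  obtain ⟨C, hC⟩ := hf
  obtain ⟨D, hD⟩ := hg
  exact ⟨C + D, fun i => (norm_sub_le _ _).trans (add_le_add (hC i) (hD i))⟩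

theorem pow {q : ℂ} (hq : ‖q‖ < 1) (n : ι → ℕ) : NormBdd fun i => q ^ n i :=
  ⟨1, fun i => by rw [norm_pow]; exact pow_le_one₀ (norm_nonneg _) hq.le⟩

/-- Follows from `1 + t ≤ exp t` and the geometric series. The bound depends neither on `n` nor on
`u` in the disc of radius `R`, as dominated convergence will require. -/
theorem norm_qPoch_le {q u : ℂ} (hq : ‖q‖ < 1) {R : ℝ} (hu : ‖u‖ ≤ R) (n : ℕ) :
    ‖qPoch u q n‖ ≤ Real.exp (R * (1 - ‖q‖)⁻¹) := by
  have hR : 0 ≤ R := (norm_nonneg u).trans hu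
  have hs := hasSum_geometric_of_lt_one (norm_nonneg q) hq
  unfold qPoch
  rw [norm_prod]
  calc ∏ k ∈ Finset.range n, ‖1 - u * q ^ k‖
      ≤ ∏ k ∈ Finset.range n, Real.exp (R * ‖q‖ ^ k) := by
        refine Finset.prod_le_prod (fun _ _ => norm_nonneg _) fun k _ => ?_
        have h1 : ‖1 - u * q ^ k‖ ≤ 1 + ‖u‖ * ‖q‖ ^ k := by
          simpa using norm_sub_le (1 : ℂ) (u * q ^ k)
        have h2 : ‖u‖ * ‖q‖ ^ k ≤ R * ‖q‖ ^ k := by gcongr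
        linarith [Real.add_one_le_exp (R * ‖q‖ ^ k)]
    _ = Real.exp (R * ∑ k ∈ Finset.range n, ‖q‖ ^ k) := by
        rw [← Real.exp_sum, Finset.mul_sum]
    _ ≤ Real.exp (R * (1 - ‖q‖)⁻¹) := by
        gcongr
        exact sum_le_hasSum _ (fun _ _ => by positivity) hs

theorem qPoch {q : ℂ} (hq : ‖q‖ < 1) {u : ι → ℂ} (hu : NormBdd u) (n : ι → ℕ) :
    NormBdd fun i => qPoch (u i) q (n i) := by
  obtain ⟨R, hR⟩ := hu
  exact ⟨_, fun i => norm_qPoch_le hq (hR i) (n i)⟩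

theorem qPochInf {q : ℂ} (hq : ‖q‖ < 1) {u : ι → ℂ} (hu : NormBdd u) :
    NormBdd fun i => qPochInf (u i) q := by
  obtain ⟨R, hR⟩ := hu
  exact ⟨_, fun i => le_of_tendsto (tendsto_qPoch hq (u i)).norm
    (Eventually.of_forall fun n => norm_qPoch_le hq (hR i) n)⟩

/-- The inverses converge because the infinite product is nonzero, and a convergent sequence is
bounded. -/
theorem inv_qPoch {x q : ℂ} (hq : ‖q‖ < 1) (h : ∀ k : ℕ, x * q ^ k ≠ 1) (n : ι → ℕ) :
    NormBdd fun i => (_root_.qPoch x q (n i))⁻¹ := by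
  have := ((tendsto_qPoch hq x).inv₀ (qPochInf_ne_zero hq h)).norm
  obtain ⟨C, hC⟩ := this.bddAbove_range
  exact ⟨C, fun i => hC ⟨n i, rfl⟩⟩

theorem summable_mul (hf : NormBdd f) (hg : Summable fun i => ‖g i‖) :
    Summable fun i => f i * g i := by
  obtain ⟨C, hC⟩ := hf
  refine .of_norm_bounded (hg.mul_left C) fun i => ?_
  rw [norm_mul]
  exact mul_le_mul_of_nonneg_right (hC i) (norm_nonneg _)

end NormBdd

theorem summable_norm_pow {q : ℂ} (hq : ‖q‖ < 1) : Summable fun n : ℕ => ‖q ^ n‖ := by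
  simpa only [norm_pow] using summable_geometric_of_lt_one (norm_nonneg q) hq

theorem summable_prod_range_of_tendsto {f : ℕ → ℝ} {l : ℝ} (hl : l < 1) (hf : ∀ i, 0 ≤ f i)
    (h : Tendsto f atTop (𝓝 l)) : Summable fun k => ∏ i ∈ Finset.range k, f i := by
  obtain ⟨r, hlr, hr⟩ := exists_between hl
  refine summable_of_ratio_norm_eventually_le hr ?_
  filter_upwards [h.eventually (gt_mem_nhds hlr)] with n hn
  rw [Finset.prod_range_succ, norm_mul, mul_comm, Real.norm_of_nonneg (hf n)]
  exact mul_le_mul_of_nonneg_right hn.le (norm_nonneg _)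

theorem self_mul_pow_ne_one {q : ℂ} (hq : ‖q‖ < 1) (k : ℕ) : q * q ^ k ≠ 1 :=
  mul_pow_ne_one_of_norm_lt hq hq k

/-! ### The nonterminating `q`-Saalschütz formula -/

/-- The summand of the nonterminating `q`-Saalschütz formula. -/
noncomputable def saalTerm (a b c x q : ℂ) (n : ℕ) : ℂ :=
  qPoch a q n * qPoch b q n * qPoch c q n * qPochInf (a * b * c * x * q ^ n) q /
    (qPoch q q n * qPoch (q / x) q n) * q ^ n

/-- The two-series combination evaluated by the nonterminating `q`-Saalschütz formula. -/
noncomputable def saalSum (a b c x q : ℂ) : ℂ :=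
  qPochInf (a * x) q * qPochInf (b * x) q * qPochInf (c * x) q / qPochInf x q *
      ∑' n, saalTerm a b c x q n +
    qPochInf a q * qPochInf b q * qPochInf c q / qPochInf (1 / x) q *
      ∑' n, saalTerm (a * x) (b * x) (c * x) (1 / x) q n

theorem saalSum_swap (a b c x q : ℂ) : saalSum a b c x q = saalSum b a c x q := by
  have h : ∀ a b c x n, saalTerm a b c x q n = saalTerm b a c x q n := by
    intro a b c x n
    unfold saalTerm
    rw [mul_comm a b]
    ring
  unfold saalSum
  simp only [h a, h (a * x)]
  ring

theorem saalSum_rotate (a b c x q : ℂ) : saalSum a b c x q = saalSum c a b x q := by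
  have h : ∀ a b c x n, saalTerm a b c x q n = saalTerm c a b x q n := by
    intro a b c x n
    unfold saalTerm
    rw [show a * b * c = c * a * b by ring]
    ring
  unfold saalSum
  simp only [h a, h (a * x)]
  ring

section

variable {q x : ℂ}

theorem normBdd_saalTerm (hq : ‖q‖ < 1) (hx : ∀ k : ℕ, q / x * q ^ k ≠ 1) {ι : Type*} (u : ι → ℂ)
    (hu : NormBdd u) (b c : ℂ) (n : ι → ℕ) :
    NormBdd fun i => qPoch (u i) q (n i) * qPoch b q (n i) * qPoch c q (n i) *
      qPochInf (u i * b * c * x * q ^ n i) q / (qPoch q q (n i) * qPoch (q / x) q (n i)) := by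
  simp only [div_eq_mul_inv _ (_ * _), mul_inv]
  have hb := NormBdd.const (ι := ι) b
  have hc := NormBdd.const (ι := ι) c
  exact ((((hu.qPoch hq n).mul (hb.qPoch hq n)).mul (hc.qPoch hq n)).mul
    (((((hu.mul hb).mul hc).mul (.const x)).mul (.pow hq n)).qPochInf hq)).mul
    ((NormBdd.inv_qPoch hq (self_mul_pow_ne_one hq) n).mul (.inv_qPoch hq hx n))

theorem summable_saalTerm (hq : ‖q‖ < 1) (hx : ∀ k : ℕ, q / x * q ^ k ≠ 1) (a b c : ℂ) :
    Summable (saalTerm a b c x q) :=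
  (normBdd_saalTerm hq hx (fun _ => a) (NormBdd.const a) b c id).summable_mul (summable_norm_pow hq)

/-- A telescoping certificate for the shift `a ↦ aq`: the right side is the antidifference, so
induction reduces to a rational identity in `q ^ N`. -/
theorem sum_saalTerm_sub (hq : ‖q‖ < 1) (hx0 : x ≠ 0) (hx : ∀ k : ℕ, q / x * q ^ k ≠ 1) (a b c : ℂ) (N : ℕ) :
    ∑ n ∈ Finset.range (N + 1), ((1 - a * x) * saalTerm a b c x q n -
        (1 - a * c * x) * (1 - a * b * x) * saalTerm (a * q) b c x q n) =
      -(a * x) * qPoch (a * q) q N * qPoch b q (N + 1) * qPoch c q (N + 1) *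
        qPochInf (a * b * c * x * q ^ (N + 1)) q / (qPoch q q N * qPoch (q / x) q N) := by
  induction N with
  | zero =>
    simp only [saalTerm, zero_add, Finset.sum_range_one, qPoch_zero, qPoch_one, pow_zero, pow_one,
      mul_one]
    rw [qPochInf_eq_mul hq (a * b * c * x), show a * q * b * c * x = a * b * c * x * q by ring]
    ring
  | succ N ih =>
    have h1 := qPoch_ne_zero (self_mul_pow_ne_one hq) N
    have h2 := qPoch_ne_zero hx N
    have h3 := sub_ne_zero.2 (self_mul_pow_ne_one hq N).symm
    have h4 := sub_ne_zero.2 (hx N).symm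
    -- The factor `1 - (q/x) q^N` with its denominator cleared.
    have h4' : x - q * q ^ N ≠ 0 := by
      intro h
      apply h4
      field_simp
      linear_combination h
    rw [Finset.sum_range_succ, ih]
    unfold saalTerm
    rw [qPochInf_eq_mul hq (a * b * c * x * q ^ (N + 1)),
      show a * q * b * c * x * q ^ (N + 1) = a * b * c * x * q ^ (N + 1) * q by ring,
      show a * b * c * x * q ^ (N + 1 + 1) = a * b * c * x * q ^ (N + 1) * q by ring,
      qPoch_succ_left a, qPoch_succ (a * q), qPoch_succ q, qPoch_succ (q / x), qPoch_succ b q (N + 1),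
      qPoch_succ c q (N + 1)]
    generalize qPochInf (a * b * c * x * q ^ (N + 1) * q) q = I
    rw [pow_succ]
    generalize q ^ N = y at *
    generalize qPoch q q N = A at *
    generalize qPoch (q / x) q N = B at *
    field_simp
    ring

theorem tsum_saalTerm_sub (hq : ‖q‖ < 1) (hx0 : x ≠ 0) (hx : ∀ k : ℕ, q / x * q ^ k ≠ 1) (a b c : ℂ) :
    (1 - a * x) * ∑' n, saalTerm a b c x q n -
        (1 - a * c * x) * (1 - a * b * x) * ∑' n, saalTerm (a * q) b c x q n =
      -(a * x) * qPochInf (a * q) q * qPochInf b q * qPochInf c q /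
        (qPochInf q q * qPochInf (q / x) q) := by
  have hs := (((summable_saalTerm hq hx a b c).hasSum.mul_left (1 - a * x)).sub
    ((summable_saalTerm hq hx (a * q) b c).hasSum.mul_left
      ((1 - a * c * x) * (1 - a * b * x)))).tendsto_sum_nat
  have hs := hs.comp (tendsto_add_atTop_nat 1)
  simp only [Function.comp_def, sum_saalTerm_sub hq hx0 hx] at hs
  refine tendsto_nhds_unique hs ?_
  have h1 := fun y => tendsto_qPoch hq y
  have h2 := fun y => (tendsto_qPoch hq y).comp (tendsto_add_atTop_nat 1)
  have h3 := (tendsto_qPochInf_mul_pow hq (a * b * c * x)).comp (tendsto_add_atTop_nat 1)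
  have := (((((h1 (a * q)).const_mul (-(a * x))).mul (h2 b)).mul (h2 c)).mul h3).div
    ((h1 q).mul (h1 (q / x))) (mul_ne_zero (qPochInf_ne_zero hq (self_mul_pow_ne_one hq))
      (qPochInf_ne_zero hq hx))
  rw [mul_one] at this
  exact this

theorem mul_pow_ne_one_of_q_mul (h : ∀ k : ℕ, x * q ^ k ≠ 1) (k : ℕ) : x * q * q ^ k ≠ 1 := by
  simpa using mul_pow_ne_one_shift h 1 k

theorem q_div_mul_pow_ne_one (h : ∀ k : ℕ, 1 / x * q ^ k ≠ 1) (k : ℕ) : q / x * q ^ k ≠ 1 := by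
  rw [show q / x = 1 / x * q by ring]; exact mul_pow_ne_one_of_q_mul h k

/-- The second series is the first under `(a, b, c, x) ↦ (ax, bx, cx, 1/x)`, which preserves `acx`
and `abx`. Both series therefore satisfy the same recurrence up to inhomogeneous terms, and the
prefactors of `saalSum` make these cancel. -/
theorem saalSum_eq_mul (hq : ‖q‖ < 1) (hx0 : x ≠ 0) (hx : ∀ k : ℕ, x * q ^ k ≠ 1)
    (hx' : ∀ k : ℕ, 1 / x * q ^ k ≠ 1) (a b c : ℂ) :
    saalSum a b c x q = (1 - a * c * x) * (1 - a * b * x) * saalSum (a * q) b c x q := by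
  have h1 := q_div_mul_pow_ne_one hx'
  have h2 : ∀ k : ℕ, q / (1 / x) * q ^ k ≠ 1 := by
    simpa [mul_comm] using mul_pow_ne_one_of_q_mul hx
  have e1 := tsum_saalTerm_sub hq hx0 h1 a b c
  have e2 := tsum_saalTerm_sub hq (one_div_ne_zero hx0) h2 (a * x) (b * x) (c * x)
  rw [show a * x * (1 / x) = a by field_simp, show a * x * (c * x) * (1 / x) = a * c * x by field_simp,
    show a * x * (b * x) * (1 / x) = a * b * x by field_simp, show q / (1 / x) = x * q by simp [mul_comm],
    mul_right_comm a x q] at e2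
  unfold saalSum
  have hxq := qPochInf_ne_zero hq (mul_pow_ne_one_of_q_mul hx)
  have hqx := qPochInf_ne_zero hq h1
  have hqq := qPochInf_ne_zero hq (self_mul_pow_ne_one hq)
  have hx1 : 1 - x ≠ 0 := sub_ne_zero.2 (by simpa using (hx 0).symm)
  have hx1' : x - 1 ≠ 0 := by rw [← neg_sub]; exact neg_ne_zero.2 hx1
  rw [qPochInf_eq_mul hq (a * x), qPochInf_eq_mul hq a, qPochInf_eq_mul hq x,
    qPochInf_eq_mul hq (1 / x), mul_right_comm a x q, show 1 / x * q = q / x by ring]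
  generalize qPochInf (a * q * x) q = A1 at *
  generalize qPochInf (b * x) q = A2 at *
  generalize qPochInf (c * x) q = A3 at *
  generalize qPochInf (a * q) q = A4 at *
  generalize qPochInf b q = A5 at *
  generalize qPochInf c q = A6 at *
  generalize qPochInf (x * q) q = X1 at *
  generalize qPochInf (q / x) q = X2 at *
  generalize qPochInf q q = Q at *
  have e1' : (1 - a * x) * ∑' n, saalTerm a b c x q n = (1 - a * c * x) * (1 - a * b * x) *
      (∑' n, saalTerm (a * q) b c x q n) + -(a * x) * A4 * A5 * A6 / (Q * X2) := by
    linear_combination e1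
  have e2' : (1 - a) * ∑' n, saalTerm (a * x) (b * x) (c * x) (1 / x) q n =
      (1 - a * c * x) * (1 - a * b * x) *
      (∑' n, saalTerm (a * q * x) (b * x) (c * x) (1 / x) q n) + -a * A1 * A2 * A3 / (Q * X1) := by
    linear_combination e2
  -- Cancellation of the inhomogeneous terms, by `1 - 1/x = -(1 - x)/x`.
  have e3 : A1 * A2 * A3 / ((1 - x) * X1) * (-(a * x) * A4 * A5 * A6 / (Q * X2)) +
      A4 * A5 * A6 / ((1 - 1 / x) * X2) * (-a * A1 * A2 * A3 / (Q * X1)) = 0 := by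
    have : 1 - 1 / x = -(1 - x) / x := by field_simp; ring
    rw [this]
    field_simp
    ring
  linear_combination A1 * A2 * A3 / ((1 - x) * X1) * e1' +
    A4 * A5 * A6 / ((1 - 1 / x) * X2) * e2' + e3

theorem tendsto_tsum_saalTerm (hq : ‖q‖ < 1) (hx : ∀ k : ℕ, q / x * q ^ k ≠ 1) (a b c : ℂ) :
    Tendsto (fun m : ℕ => ∑' n, saalTerm (a * q ^ m) b c x q n) atTop
      (𝓝 (∑' n, saalTerm 0 b c x q n)) := by
  -- Indexing by pairs `(m, n)` gives a single constant for all `m`, hence the dominating series `C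
  -- ‖q ^ n‖`.
  obtain ⟨C, hC⟩ := normBdd_saalTerm hq hx (fun i : ℕ × ℕ => a * q ^ i.1)
    ((NormBdd.const a).mul (.pow hq _)) b c (fun i => i.2)
  refine tendsto_tsum_of_dominated_convergence ((summable_norm_pow hq).mul_left C) (fun n => ?_)
    (Eventually.of_forall fun m n => ?_)
  · have h1 : Tendsto (fun m : ℕ => qPoch (a * q ^ m) q n) atTop (𝓝 (qPoch 0 q n)) := by
      unfold qPoch
      exact tendsto_finsetProd _ fun k _ => ((tendsto_mul_pow hq a).mul_const _).const_sub 1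
    have h2 : Tendsto (fun m : ℕ => qPochInf (a * q ^ m * b * c * x * q ^ n) q) atTop
        (𝓝 (qPochInf (0 * b * c * x * q ^ n) q)) := by
      simp only [zero_mul, qPochInf_zero_left]
      refine (tendsto_qPochInf_mul_pow hq (a * b * c * x * q ^ n)).congr fun m => ?_
      ring_nf
    unfold saalTerm
    exact ((((h1.mul_const _).mul_const _).mul h2).div_const _).mul_const _
  · rw [saalTerm, norm_mul]
    exact mul_le_mul_of_nonneg_right (hC (m, n)) (norm_nonneg _)

theorem tendsto_saalSum (hq : ‖q‖ < 1) (hx : ∀ k : ℕ, x * q ^ k ≠ 1)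
    (hx' : ∀ k : ℕ, 1 / x * q ^ k ≠ 1) (a b c : ℂ) :
    Tendsto (fun m : ℕ => saalSum (a * q ^ m) b c x q) atTop (𝓝 (saalSum 0 b c x q)) := by
  have h1 := q_div_mul_pow_ne_one hx'
  have h2 : ∀ k : ℕ, q / (1 / x) * q ^ k ≠ 1 := by
    simpa [mul_comm] using mul_pow_ne_one_of_q_mul hx
  have t1 := tendsto_tsum_saalTerm hq h1 a b c
  have t2 := tendsto_tsum_saalTerm hq h2 (a * x) (b * x) (c * x)
  have t3 := tendsto_qPochInf_mul_pow hq a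
  have t4 := tendsto_qPochInf_mul_pow hq (a * x)
  unfold saalSum
  simp only [zero_mul, qPochInf_zero_left]
  simp only [mul_right_comm a _ x]
  exact ((((t4.mul_const _).mul_const _).div_const _).mul t1).add
    ((((t3.mul_const _).mul_const _).div_const _).mul t2)

theorem saalSum_eq_mul_zero (hq : ‖q‖ < 1) (hx0 : x ≠ 0) (hx : ∀ k : ℕ, x * q ^ k ≠ 1)
    (hx' : ∀ k : ℕ, 1 / x * q ^ k ≠ 1) (a b c : ℂ) :
    saalSum a b c x q =
      qPochInf (a * c * x) q * qPochInf (a * b * x) q * saalSum 0 b c x q := by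
  have h : ∀ m : ℕ, qPoch (a * c * x) q m * qPoch (a * b * x) q m * saalSum (a * q ^ m) b c x q =
      saalSum a b c x q := by
    intro m
    induction m with
    | zero => simp [qPoch_zero]
    | succ m ih =>
      rw [← ih, saalSum_eq_mul hq hx0 hx hx' (a * q ^ m), qPoch_succ, qPoch_succ, pow_succ,
        mul_assoc a (q ^ m) q]
      ring
  refine tendsto_nhds_unique (tendsto_const_nhds (x := saalSum a b c x q) (f := atTop (α := ℕ))) ?_
  refine Tendsto.congr h ?_
  exact ((tendsto_qPoch hq _).mul (tendsto_qPoch hq _)).mul (tendsto_saalSum hq hx hx' a b c)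

/-- The nonterminating `q`-Saalschütz formula. -/
theorem saalSum_eq (hq : ‖q‖ < 1) (hx0 : x ≠ 0) (hx : ∀ k : ℕ, x * q ^ k ≠ 1)
    (hx' : ∀ k : ℕ, 1 / x * q ^ k ≠ 1) (a b c : ℂ) :
    saalSum a b c x q =
      qPochInf (b * c * x) q * qPochInf (a * c * x) q * qPochInf (a * b * x) q := by
  have h0 := saalSum_eq_mul_zero hq hx0 hx hx'
  -- At `a = 1` the second half vanishes through `(1;q)_∞ = 0`, and only the `n = 0` term of the
  -- first survives.
  have h1 : saalSum 1 0 0 x q = 1 := by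
    have hz : ∀ n, n ≠ 0 → saalTerm 1 0 0 x q n = 0 := by
      intro n hn
      obtain ⟨n, rfl⟩ := Nat.exists_eq_succ_of_ne_zero hn
      simp [saalTerm, qPoch_succ_left 1]
    rw [saalSum, tsum_eq_single 0 hz, qPochInf_one_left hq]
    simp [saalTerm, qPoch_zero, qPochInf_zero_left, div_self (qPochInf_ne_zero hq hx)]
  have h2 : saalSum 0 0 0 x q = 1 := by
    rw [h0 1] at h1
    simpa [qPochInf_zero_left] using h1
  have h3 : saalSum 0 0 c x q = 1 := by
    rw [saalSum_rotate, h0, h2]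
    simp [qPochInf_zero_left]
  rw [h0 a, saalSum_swap, h0 b, h3]
  simp only [mul_zero, zero_mul, qPochInf_zero_left]
  ring

end

/-! ### Rogers' very-well-poised summation -/

/-- The product `∏_{i<k} (B - a q^{i+1}) (γ - q^i)`. -/
noncomputable def rogersNum (a B γ q : ℂ) (k : ℕ) : ℂ :=
  ∏ i ∈ Finset.range k, (B - a * q ^ (i + 1)) * (γ - q ^ i)

/-- The product `∏_{i<k} (δ - q^i)`. -/
noncomputable def powSubProd (δ q : ℂ) (k : ℕ) : ℂ := ∏ i ∈ Finset.range k, (δ - q ^ i)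

/-- The very-well-poised coefficient with parameters `a`, `b = aq/B`, `c = 1/γ`. -/
noncomputable def rogersCoeff (a B γ q : ℂ) (k : ℕ) : ℂ :=
  qPoch a q k * (1 - a * q ^ (2 * k)) / (1 - a) /
    (qPoch q q k * qPoch B q k * qPoch (a * q * γ) q k) * rogersNum a B γ q k

/-- The summand of Rogers' very-well-poised series with parameters `a`, `aq/B`, `1/γ`, `1/δ`,
multiplied by `(aqδ;q)_∞`. -/
noncomputable def rogersTerm (a B γ q δ : ℂ) (k : ℕ) : ℂ :=
  rogersCoeff a B γ q k * powSubProd δ q k * qPochInf (a * q * δ * q ^ k) q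

theorem rogersNum_succ (a B γ q : ℂ) (k : ℕ) : rogersNum a B γ q (k + 1) =
    rogersNum a B γ q k * ((B - a * q ^ (k + 1)) * (γ - q ^ k)) := by
  simp [rogersNum, Finset.prod_range_succ]

theorem powSubProd_succ (δ q : ℂ) (k : ℕ) :
    powSubProd δ q (k + 1) = powSubProd δ q k * (δ - q ^ k) := by
  simp [powSubProd, Finset.prod_range_succ]

theorem powSubProd_mul_succ (δ q : ℂ) (k : ℕ) :
    powSubProd (δ * q) q (k + 1) = (δ * q - 1) * q ^ k * powSubProd δ q k := by
  have h : ∀ i : ℕ, δ * q - q ^ (i + 1) = q * (δ - q ^ i) := fun i => by ring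
  simp only [powSubProd, Finset.prod_range_succ', h, Finset.prod_mul_distrib, Finset.prod_const,
    Finset.card_range]
  ring

theorem powSubProd_pow_eq_zero (q : ℂ) {N k : ℕ} (h : N < k) : powSubProd (q ^ N) q k = 0 :=
  Finset.prod_eq_zero (Finset.mem_range.2 h) (sub_self _)

section

variable {a B γ q : ℂ}

/-- The `i`-th factor of the product is bounded, uniformly in `u`, by a sequence tending to `‖B‖ *
‖γ‖ * R < 1`; the ratio test applies to the product of these bounds. -/
theorem exists_rogers_majorant (hq : ‖q‖ < 1) {R : ℝ} (hR0 : 0 ≤ R) (hR : ‖B‖ * ‖γ‖ * R < 1)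
    (a : ℂ) : ∃ g : ℕ → ℝ, Summable g ∧ ∀ u : ℂ, ‖u‖ ≤ R → ∀ k,
      ‖rogersNum a B γ q k * powSubProd u q k‖ ≤ g k := by
  have ht : Tendsto (fun i : ℕ => ‖q‖ ^ i) atTop (𝓝 0) :=
    tendsto_pow_atTop_nhds_zero_of_lt_one (norm_nonneg _) hq
  have h1 : Tendsto (fun i : ℕ => (‖B‖ + ‖a‖ * ‖q‖ ^ (i + 1)) * (‖γ‖ + ‖q‖ ^ i) * (R + ‖q‖ ^ i))
      atTop (𝓝 ((‖B‖ + ‖a‖ * 0) * (‖γ‖ + 0) * (R + 0))) :=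
    (((((tendsto_add_atTop_iff_nat 1).2 ht).const_mul _).const_add _).mul (ht.const_add _)).mul
      (ht.const_add _)
  refine ⟨_, summable_prod_range_of_tendsto (by simpa using hR) (fun i => by positivity) h1,
    fun u hu k => ?_⟩
  rw [rogersNum, powSubProd, ← Finset.prod_mul_distrib, norm_prod]
  refine Finset.prod_le_prod (fun _ _ => norm_nonneg _) fun i _ => ?_
  rw [norm_mul, norm_mul]
  have e1 : ‖B - a * q ^ (i + 1)‖ ≤ ‖B‖ + ‖a‖ * ‖q‖ ^ (i + 1) := by
    simpa only [norm_mul, norm_pow] using norm_sub_le B (a * q ^ (i + 1))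
  have e2 : ‖γ - q ^ i‖ ≤ ‖γ‖ + ‖q‖ ^ i := by simpa only [norm_pow] using norm_sub_le γ (q ^ i)
  have e3 : ‖u - q ^ i‖ ≤ R + ‖q‖ ^ i := by
    have := norm_sub_le u (q ^ i)
    rw [norm_pow] at this
    linarith
  gcongr

theorem summable_rogersNum_mul (hq : ‖q‖ < 1) {δ : ℂ} (h : ‖B * γ * δ‖ < 1) (a : ℂ) :
    Summable fun k => ‖rogersNum a B γ q k * powSubProd δ q k‖ := by
  rw [norm_mul, norm_mul] at h
  obtain ⟨g, hg, hb⟩ := exists_rogers_majorant hq (norm_nonneg δ) h a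
  exact hg.of_nonneg_of_le (fun _ => norm_nonneg _) (hb δ le_rfl)

theorem summable_rogersNum_mul_pow (a B γ q : ℂ) (N : ℕ) :
    Summable fun k => ‖rogersNum a B γ q k * powSubProd (q ^ N) q k‖ := by
  refine summable_of_ne_finset_zero (s := Finset.range (N + 1)) fun k hk => ?_
  rw [powSubProd_pow_eq_zero q (by simpa using hk), mul_zero, norm_zero]

theorem normBdd_rogersCoeff_factor (hq : ‖q‖ < 1) (hB : ∀ k : ℕ, B * q ^ k ≠ 1)
    (hγ : ∀ k : ℕ, a * q * γ * q ^ k ≠ 1) :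
    NormBdd fun k : ℕ => qPoch a q k * (1 - a * q ^ (2 * k)) / (1 - a) /
      (qPoch q q k * qPoch B q k * qPoch (a * q * γ) q k) := by
  simp only [div_eq_mul_inv _ (_ * _), div_eq_mul_inv _ (1 - a), mul_inv]
  exact ((((NormBdd.const a).qPoch hq _).mul ((NormBdd.const 1).sub
    ((NormBdd.const a).mul (.pow hq _)))).mul (.const _)).mul
    (((NormBdd.inv_qPoch hq (self_mul_pow_ne_one hq) _).mul (.inv_qPoch hq hB _)).mul
      (.inv_qPoch hq hγ _))

theorem exists_rogersTerm_majorant (hq : ‖q‖ < 1) (hB : ∀ k : ℕ, B * q ^ k ≠ 1)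
    (hγ : ∀ k : ℕ, a * q * γ * q ^ k ≠ 1) {R : ℝ} (hR0 : 0 ≤ R) (hR : ‖B‖ * ‖γ‖ * R < 1) :
    ∃ g : ℕ → ℝ, Summable g ∧ ∀ u : ℂ, ‖u‖ ≤ R → ∀ k, ‖rogersTerm a B γ q u k‖ ≤ g k := by
  obtain ⟨g, hg, hb⟩ := exists_rogers_majorant hq hR0 hR a
  obtain ⟨C, hC⟩ := normBdd_rogersCoeff_factor hq hB hγ
  obtain ⟨D, hD⟩ : NormBdd fun i : {u : ℂ // ‖u‖ ≤ R} × ℕ =>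
      qPochInf (a * q * i.1 * q ^ i.2) q :=
    (((NormBdd.const (a * q)).mul ⟨R, fun i => i.1.2⟩).mul (.pow hq _)).qPochInf hq
  refine ⟨_, hg.mul_left (C * D), fun u hu k => ?_⟩
  have h1 := hC k
  have h2 := hD (⟨u, hu⟩, k)
  have h3 := hb u hu k
  rw [rogersTerm, rogersCoeff, mul_assoc (_ / _), mul_right_comm, norm_mul, norm_mul]
  exact mul_le_mul (mul_le_mul h1 h2 (norm_nonneg _) ((norm_nonneg _).trans h1)) h3 (norm_nonneg _)
    (mul_nonneg ((norm_nonneg _).trans h1) ((norm_nonneg _).trans h2))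

theorem summable_rogersTerm (hq : ‖q‖ < 1) (hB : ∀ k : ℕ, B * q ^ k ≠ 1)
    (hγ : ∀ k : ℕ, a * q * γ * q ^ k ≠ 1) {δ : ℂ}
    (h : Summable fun k => ‖rogersNum a B γ q k * powSubProd δ q k‖) :
    Summable (rogersTerm a B γ q δ) := by
  refine (((normBdd_rogersCoeff_factor hq hB hγ).mul
    ((((NormBdd.const (a * q * δ)).mul (.pow hq id))).qPochInf hq)).summable_mul h).congr
    fun k => ?_
  simp only [rogersTerm, rogersCoeff, id]
  ring

/-- The telescoping certificate for the shift `δ ↦ δq`. -/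
theorem sum_rogersTerm_sub (hq : ‖q‖ < 1) (ha : a ≠ 1) (hB : ∀ k : ℕ, B * q ^ k ≠ 1)
    (hγ : ∀ k : ℕ, a * q * γ * q ^ k ≠ 1) (δ : ℂ) (n : ℕ) :
    ∑ k ∈ Finset.range (n + 1), ((1 - B * γ * δ) * rogersTerm a B γ q δ k -
        (1 - B * δ) * (1 - a * q * γ * δ) * rogersTerm a B γ q (δ * q) k) =
      -δ * qPoch (a * q) q n * rogersNum a B γ q (n + 1) * powSubProd δ q n *
        qPochInf (a * q * δ * q ^ (n + 1)) q /
        (qPoch q q n * qPoch B q n * qPoch (a * q * γ) q n) := by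
  have ha' : 1 - a ≠ 0 := sub_ne_zero.2 ha.symm
  induction n with
  | zero =>
    simp only [rogersTerm, rogersCoeff, zero_add, Finset.sum_range_one, qPoch_zero, pow_zero,
      pow_one, mul_one, rogersNum, powSubProd, Finset.prod_range_zero, Finset.prod_range_one,
      mul_zero]
    rw [qPochInf_eq_mul hq (a * q * δ), ← mul_assoc (a * q) δ q]
    field_simp
    ring
  | succ n ih =>
    have h1 := qPoch_ne_zero (self_mul_pow_ne_one hq) n
    have h2 := qPoch_ne_zero hB n
    have h3 := qPoch_ne_zero hγ n
    have h4 := sub_ne_zero.2 (self_mul_pow_ne_one hq n).symm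
    have h5 := sub_ne_zero.2 (hB n).symm
    have h6 := sub_ne_zero.2 (hγ n).symm
    rw [Finset.sum_range_succ, ih]
    unfold rogersTerm rogersCoeff
    rw [qPochInf_eq_mul hq (a * q * δ * q ^ (n + 1)),
      show a * q * (δ * q) * q ^ (n + 1) = a * q * δ * q ^ (n + 1) * q by ring,
      show a * q * δ * q ^ (n + 1 + 1) = a * q * δ * q ^ (n + 1) * q by ring,
      qPoch_succ_left a, qPoch_succ (a * q), qPoch_succ q, qPoch_succ B, qPoch_succ (a * q * γ),
      rogersNum_succ _ _ _ _ (n + 1), powSubProd_succ, powSubProd_mul_succ]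
    generalize qPochInf (a * q * δ * q ^ (n + 1) * q) q = I
    rw [mul_comm 2, pow_mul, pow_succ q (n + 1), pow_succ q n]
    generalize q ^ n = y at *
    generalize qPoch q q n = A1 at *
    generalize qPoch B q n = A2 at *
    generalize qPoch (a * q * γ) q n = A3 at *
    generalize hd : 1 - a * q * γ * y = d at *
    generalize he : 1 - B * y = e at *
    field_simp
    rw [← hd, ← he]
    ring

/-- The boundary term is a bounded factor times a summable sequence, so it tends to 0. Assuming
summability instead of `‖B * γ * δ‖ < 1` also covers the terminating values `δ = q ^ N`. -/
theorem tsum_rogersTerm_sub (hq : ‖q‖ < 1) (ha : a ≠ 1) (hB : ∀ k : ℕ, B * q ^ k ≠ 1)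
    (hγ : ∀ k : ℕ, a * q * γ * q ^ k ≠ 1) {δ : ℂ}
    (h : Summable fun k => ‖rogersNum a B γ q k * powSubProd δ q k‖)
    (h' : Summable fun k => ‖rogersNum a B γ q k * powSubProd (δ * q) q k‖) :
    (1 - B * γ * δ) * ∑' k, rogersTerm a B γ q δ k =
      (1 - B * δ) * (1 - a * q * γ * δ) * ∑' k, rogersTerm a B γ q (δ * q) k := by
  have hs := (((summable_rogersTerm hq hB hγ h).hasSum.mul_left (1 - B * γ * δ)).sub
    ((summable_rogersTerm hq hB hγ h').hasSum.mul_left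
      ((1 - B * δ) * (1 - a * q * γ * δ)))).tendsto_sum_nat
  have hs := hs.comp (tendsto_add_atTop_nat 1)
  simp only [Function.comp_def, sum_rogersTerm_sub hq ha hB hγ] at hs
  refine sub_eq_zero.1 (tendsto_nhds_unique hs ?_)
  have hb : NormBdd fun n : ℕ => -δ * qPoch (a * q) q n * qPochInf (a * q * δ * q ^ (n + 1)) q *
      ((qPoch q q n)⁻¹ * (qPoch B q n)⁻¹ * (qPoch (a * q * γ) q n)⁻¹) *
      ((B - a * q ^ (n + 1)) * (γ - q ^ n)) :=
    ((((NormBdd.const _).mul ((NormBdd.const _).qPoch hq _)).mul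
      (((NormBdd.const _).mul (.pow hq _)).qPochInf hq)).mul
      (((NormBdd.inv_qPoch hq (self_mul_pow_ne_one hq) _).mul (.inv_qPoch hq hB _)).mul
        (.inv_qPoch hq hγ _))).mul
      (((NormBdd.const B).sub ((NormBdd.const a).mul (.pow hq _))).mul
        ((NormBdd.const γ).sub (.pow hq _)))
  refine (hb.summable_mul h).tendsto_atTop_zero.congr fun n => ?_
  rw [rogersNum_succ]
  simp only [div_eq_mul_inv, mul_inv]
  ring

theorem tsum_rogersTerm_pow (hq : ‖q‖ < 1) (ha : a ≠ 1) (hB : ∀ k : ℕ, B * q ^ k ≠ 1)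
    (hγ : ∀ k : ℕ, a * q * γ * q ^ k ≠ 1) (N : ℕ) :
    ∑' k, rogersTerm a B γ q (q ^ N) k =
      qPochInf (a * q) q * qPoch (B * γ) q N / (qPoch B q N * qPoch (a * q * γ) q N) := by
  induction N with
  | zero =>
    rw [tsum_eq_single 0 fun k hk => by
      rw [rogersTerm, powSubProd_pow_eq_zero q (Nat.pos_of_ne_zero hk)]; ring]
    simp [rogersTerm, rogersCoeff, rogersNum, powSubProd, qPoch_zero,
      div_self (sub_ne_zero.2 ha.symm)]
  | succ N ih =>
    have h := tsum_rogersTerm_sub hq ha hB hγ (summable_rogersNum_mul_pow a B γ q N)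
      (by simpa only [← pow_succ] using summable_rogersNum_mul_pow a B γ q (N + 1))
    rw [ih, ← pow_succ] at h
    have h2 := qPoch_ne_zero hB N
    have h3 := qPoch_ne_zero hγ N
    have h5 := sub_ne_zero.2 (hB N).symm
    have h6 := sub_ne_zero.2 (hγ N).symm
    rw [qPoch_succ, qPoch_succ, qPoch_succ]
    generalize qPoch (a * q * γ) q N = A3 at *
    generalize 1 - a * q * γ * q ^ N = d at *
    field_simp at h ⊢
    linear_combination -h

theorem tendsto_tsum_rogersTerm (hq : ‖q‖ < 1) (hB : ∀ k : ℕ, B * q ^ k ≠ 1)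
    (hγ : ∀ k : ℕ, a * q * γ * q ^ k ≠ 1) {δ : ℂ} (hδ : ‖B * γ * δ‖ < 1) :
    Tendsto (fun m : ℕ => ∑' k, rogersTerm a B γ q (δ * q ^ m) k) atTop
      (𝓝 (∑' k, rogersTerm a B γ q 0 k)) := by
  rw [norm_mul, norm_mul] at hδ
  obtain ⟨g, hg, hb⟩ := exists_rogersTerm_majorant hq hB hγ (norm_nonneg δ) hδ
  refine tendsto_tsum_of_dominated_convergence hg (fun k => ?_)
    (Eventually.of_forall fun m k => hb _ ?_ k)
  · have h1 : Tendsto (fun m : ℕ => powSubProd (δ * q ^ m) q k) atTop (𝓝 (powSubProd 0 q k)) := by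
      unfold powSubProd
      exact tendsto_finsetProd _ fun k _ => (tendsto_mul_pow hq δ).sub_const _
    have h2 : Tendsto (fun m : ℕ => qPochInf (a * q * (δ * q ^ m) * q ^ k) q) atTop
        (𝓝 (qPochInf (a * q * 0 * q ^ k) q)) := by
      simp only [mul_zero, zero_mul, qPochInf_zero_left]
      refine (tendsto_qPochInf_mul_pow hq (a * q * δ * q ^ k)).congr fun m => ?_
      ring_nf
    exact (h1.const_mul _).mul h2
  · rw [norm_mul, norm_pow]
    exact mul_le_of_le_one_right (norm_nonneg _) (pow_le_one₀ (norm_nonneg _) hq.le)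

theorem tsum_rogersTerm_zero (hq : ‖q‖ < 1) (ha : a ≠ 1) (hB : ∀ k : ℕ, B * q ^ k ≠ 1)
    (hγ : ∀ k : ℕ, a * q * γ * q ^ k ≠ 1) :
    ∑' k, rogersTerm a B γ q 0 k =
      qPochInf (a * q) q * qPochInf (B * γ) q / (qPochInf B q * qPochInf (a * q * γ) q) := by
  -- Dominated convergence needs a starting point in the convergence region; `δ = q ^ M` is one, and
  -- every later `q ^ (M + m)` has a known sum.
  obtain ⟨M, hM⟩ : ∃ M : ℕ, ‖B * γ * q ^ M‖ < 1 := by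
    have := (tendsto_mul_pow hq (B * γ)).norm
    rw [norm_zero] at this
    exact (this.eventually (gt_mem_nhds one_pos)).exists
  refine tendsto_nhds_unique (tendsto_tsum_rogersTerm hq hB hγ hM) ?_
  have h := ((tendsto_qPoch hq (B * γ)).const_mul (qPochInf (a * q) q)).div
    ((tendsto_qPoch hq B).mul (tendsto_qPoch hq (a * q * γ)))
    (mul_ne_zero (qPochInf_ne_zero hq hB) (qPochInf_ne_zero hq hγ))
  refine (h.comp (tendsto_add_atTop_nat M)).congr fun m => ?_
  rw [← pow_add, add_comm M, tsum_rogersTerm_pow hq ha hB hγ]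
  rfl

/-- Rogers' nonterminating very-well-poised summation. -/
theorem tsum_rogersTerm (hq : ‖q‖ < 1) (ha : a ≠ 1) (hB : ∀ k : ℕ, B * q ^ k ≠ 1)
    (hγ : ∀ k : ℕ, a * q * γ * q ^ k ≠ 1) {δ : ℂ} (hδ : ‖B * γ * δ‖ < 1) :
    ∑' k, rogersTerm a B γ q δ k =
      qPochInf (a * q) q * qPochInf (B * γ) q * qPochInf (B * δ) q * qPochInf (a * q * γ * δ) q /
        (qPochInf B q * qPochInf (a * q * γ) q * qPochInf (B * γ * δ) q) := by
  have hm : ∀ m : ℕ, ‖B * γ * (δ * q ^ m)‖ < 1 := fun m => by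
    rw [← mul_assoc, norm_mul, norm_pow]
    exact (mul_le_of_le_one_right (norm_nonneg _) (pow_le_one₀ (norm_nonneg _) hq.le)).trans_lt hδ
  have h : ∀ m : ℕ, qPoch (B * γ * δ) q m * ∑' k, rogersTerm a B γ q δ k =
      qPoch (B * δ) q m * qPoch (a * q * γ * δ) q m * ∑' k, rogersTerm a B γ q (δ * q ^ m) k := by
    intro m
    induction m with
    | zero => simp [qPoch_zero]
    | succ m ih =>
      have := tsum_rogersTerm_sub hq ha hB hγ (summable_rogersNum_mul hq (hm m) a)
        (by simpa only [pow_succ, mul_assoc] using summable_rogersNum_mul hq (hm (m + 1)) a)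
      rw [mul_assoc δ, ← pow_succ] at this
      rw [qPoch_succ, qPoch_succ, qPoch_succ]
      linear_combination (1 - B * γ * δ * q ^ m) * ih +
        qPoch (B * δ) q m * qPoch (a * q * γ * δ) q m * this
  have h1 := tendsto_nhds_unique (((tendsto_qPoch hq (B * γ * δ)).mul_const _).congr h)
    (((tendsto_qPoch hq (B * δ)).mul (tendsto_qPoch hq (a * q * γ * δ))).mul
      (tendsto_tsum_rogersTerm hq hB hγ hδ))
  have h2 := qPochInf_ne_zero hq (mul_pow_ne_one_of_norm_lt hq hδ)
  have h3 := qPochInf_ne_zero hq hB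
  have h4 := qPochInf_ne_zero hq hγ
  rw [tsum_rogersTerm_zero hq ha hB hγ] at h1
  field_simp at h1 ⊢
  linear_combination h1

end

/-! ### The three-term transformation -/

theorem powSubProd_eq_pow_mul {x : ℂ} (hx0 : x ≠ 0) (q : ℂ) (k : ℕ) :
    powSubProd x q k = x ^ k * qPoch (1 / x) q k := by
  induction k with
  | zero => simp [powSubProd, qPoch_zero]
  | succ k ih => rw [powSubProd_succ, ih, qPoch_succ]; field_simp; ring

/-- Reversal of the factors of `(x/q^k;q)_k`; here `powSubProd 0 q k` is `(-1)^k q^(k choose 2)`. -/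
theorem qPoch_div_pow_mul {q x : ℂ} (hq0 : q ≠ 0) (hx0 : x ≠ 0) (k : ℕ) :
    qPoch (x / q ^ k) q k * (q ^ k * powSubProd 0 q k) = x ^ k * qPoch (q / x) q k := by
  induction k with
  | zero => simp [powSubProd, qPoch_zero]
  | succ k ih =>
    rw [qPoch_succ_left, powSubProd_succ, qPoch_succ, pow_succ x,
      show x / q ^ (k + 1) * q = x / q ^ k by field_simp; ring]
    rw [show x ^ k * x * (qPoch (q / x) q k * (1 - q / x * q ^ k)) =
      x ^ k * qPoch (q / x) q k * (x - q * q ^ k) by field_simp, ← ih]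
    field_simp
    ring

theorem qPoch_mul_powSubProd {q : ℂ} (hq0 : q ≠ 0) (x : ℂ) (k j : ℕ) :
    powSubProd (x * q ^ j) q k * qPoch (x * q / q ^ k) q j =
      powSubProd x q k * qPoch (x * q) q j := by
  induction j with
  | zero => simp [qPoch_zero]
  | succ j ih =>
    have h : (1 - x * q / q ^ k * q ^ j) * powSubProd (x * q ^ (j + 1)) q k =
        (1 - x * q * q ^ j) * powSubProd (x * q ^ j) q k := by
      -- The product with `k + 1` factors at `x q^(j+1)`, peeled from either end.
      have h1 := powSubProd_mul_succ (x * q ^ j) q k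
      rw [powSubProd_succ, mul_assoc x, ← pow_succ] at h1
      field_simp
      rw [pow_succ] at h1 ⊢
      linear_combination -h1
    rw [qPoch_succ, qPoch_succ]
    linear_combination qPoch (x * q / q ^ k) q j * h + (1 - x * q * q ^ j) * ih

/-- With `N = k + n`, this trades `1/(q;q)_n` for `1/(q;q)_N` times the factor that terminates
Rogers' series at `δ = q ^ N`. -/
theorem powSubProd_zero_mul_qPoch (q : ℂ) (n k : ℕ) :
    powSubProd 0 q k * qPoch q q (k + n) = powSubProd (q ^ (k + n)) q k * qPoch q q n := by
  induction k with
  | zero => simp [powSubProd]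
  | succ k ih =>
    rw [add_right_comm, qPoch_succ, pow_succ, powSubProd_mul_succ, powSubProd_succ]
    linear_combination (-q ^ k) * (1 - q * q ^ (k + n)) * ih

theorem tsum_tsum_eq_tsum_sum_antidiagonal {F : ℕ × ℕ → ℂ} (hF : Summable F) :
    ∑' k, ∑' n, F (k, n) = ∑' N, ∑ p ∈ Finset.HasAntidiagonal.antidiagonal N, F p := by
  rw [← hF.tsum_prod, ← Finset.HasAntidiagonal.sigmaAntidiagonalEquivProd.tsum_eq F]
  refine (Summable.tsum_sigma' (fun n => (hasSum_fintype _).summable)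
      (Finset.HasAntidiagonal.sigmaAntidiagonalEquivProd.summable_iff.2 hF)).trans (tsum_congr fun N => ?_)
  rw [tsum_fintype]
  exact Finset.sum_coe_sort (Finset.HasAntidiagonal.antidiagonal N) F

/-- The summand of the very-well-poised `₈φ₇` series with parameters
`a = defx/q`, `aq/B`, `1/γ`, `d`, `e`, `f`. -/
noncomputable def wellPoisedTerm (a B γ d e f x q : ℂ) (k : ℕ) : ℂ :=
  rogersCoeff a B γ q k * (qPoch d q k * qPoch e q k * qPoch f q k /
    (qPoch (e * f * x) q k * qPoch (d * f * x) q k * qPoch (d * e * x) q k)) * x ^ k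

/-- The double series arising from the first half of the `q`-Saalschütz formula. -/
noncomputable def leftDouble (a B γ d e f x q : ℂ) (p : ℕ × ℕ) : ℂ :=
  rogersCoeff a B γ q p.1 * (q ^ p.1 * powSubProd 0 q p.1) *
    (qPoch d q (p.1 + p.2) * qPoch e q (p.1 + p.2) * qPoch f q (p.1 + p.2) *
      qPochInf (a * q * q ^ (p.1 + p.2) * q ^ p.1) q /
      (qPoch q q p.2 * qPoch (q / x) q (p.1 + p.2))) * q ^ p.2

/-- The double series arising from the second half of the `q`-Saalschütz formula. -/
noncomputable def rightDouble (a B γ d e f x q : ℂ) (p : ℕ × ℕ) : ℂ :=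
  rogersTerm a B γ q (x * q ^ p.2) p.1 *
    (qPoch (d * x) q p.2 * qPoch (e * x) q p.2 * qPoch (f * x) q p.2 /
      (qPoch q q p.2 * qPoch (x * q) q p.2) * q ^ p.2)

section

variable {q a B γ d e f x : ℂ}

/-- The Gaussian factor `powSubProd 0 q k` forces convergence whatever the size of `B * γ * x`. -/
theorem summable_leftDouble (hq : ‖q‖ < 1) (hB : ∀ k : ℕ, B * q ^ k ≠ 1)
    (hγ : ∀ k : ℕ, a * q * γ * q ^ k ≠ 1) (hx : ∀ k : ℕ, q / x * q ^ k ≠ 1) :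
    Summable (leftDouble a B γ d e f x q) := by
  have hs := (summable_rogersNum_mul (B := B) (γ := γ) (δ := 0) hq (by simp) a).mul_norm
    (summable_norm_pow hq)
  obtain ⟨C, hC⟩ := normBdd_rogersCoeff_factor hq hB hγ
  have hb : NormBdd fun p : ℕ × ℕ => qPoch a q p.1 * (1 - a * q ^ (2 * p.1)) / (1 - a) /
      (qPoch q q p.1 * qPoch B q p.1 * qPoch (a * q * γ) q p.1) := ⟨C, fun p => hC p.1⟩
  have hd := fun u => (NormBdd.const (ι := ℕ × ℕ) u).qPoch hq fun p => p.1 + p.2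
  have hi := (((NormBdd.const (ι := ℕ × ℕ) (a * q)).mul (.pow hq fun p => p.1 + p.2)).mul
    (.pow hq fun p => p.1)).qPochInf hq
  have hh := ((hb.mul (.pow hq fun p => p.1)).mul ((((hd d).mul (hd e)).mul (hd f)).mul hi)).mul
    ((NormBdd.inv_qPoch hq (self_mul_pow_ne_one hq) fun p => p.2).mul
      (.inv_qPoch hq hx fun p => p.1 + p.2))
  refine (hh.summable_mul hs).congr fun p => ?_
  simp only [leftDouble, rogersCoeff, div_eq_mul_inv _ (_ * _), mul_inv]
  ring

/-- All `δ = x q^j` lie in the disc of radius `‖x‖`, so one majorant in `k` serves every `j`, and `q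
^ j` gives convergence in `j`. -/
theorem summable_rightDouble (hq : ‖q‖ < 1) (hB : ∀ k : ℕ, B * q ^ k ≠ 1)
    (hγ : ∀ k : ℕ, a * q * γ * q ^ k ≠ 1) (hx : ∀ k : ℕ, x * q ^ k ≠ 1)
    (hz : ‖B * γ * x‖ < 1) :
    Summable (rightDouble a B γ d e f x q) := by
  rw [norm_mul, norm_mul] at hz
  obtain ⟨g, hg, hb⟩ := exists_rogersTerm_majorant hq hB hγ (norm_nonneg x) hz
  have hd := fun u => (NormBdd.const (ι := ℕ) u).qPoch hq id
  have hs : Summable fun j : ℕ => ‖(qPoch (d * x) q j * qPoch (e * x) q j * qPoch (f * x) q j /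
      (qPoch q q j * qPoch (x * q) q j) * q ^ j)‖ := by
    refine Summable.norm (NormBdd.summable_mul ?_ (summable_norm_pow hq))
    simp only [div_eq_mul_inv _ (_ * _), mul_inv]
    exact (((hd _).mul (hd _)).mul (hd _)).mul
      ((NormBdd.inv_qPoch hq (self_mul_pow_ne_one hq) _).mul
        (.inv_qPoch hq (mul_pow_ne_one_of_q_mul hx) _))
  have hg0 : ∀ k, 0 ≤ g k := fun k => (norm_nonneg _).trans (hb 0 (by simp) k)
  refine .of_norm_bounded (hg.mul_of_nonneg hs hg0 fun _ => norm_nonneg _) fun p => ?_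
  rw [rightDouble, norm_mul]
  refine mul_le_mul_of_nonneg_right (hb _ ?_ _) (norm_nonneg _)
  rw [norm_mul, norm_pow]
  exact mul_le_of_le_one_right (norm_nonneg _) (pow_le_one₀ (norm_nonneg _) hq.le)

theorem div_pow_mul_pow_ne_one (hq0 : q ≠ 0) (hx0 : x ≠ 0) (hx : ∀ k : ℕ, x * q ^ k ≠ 1)
    (hx' : ∀ k : ℕ, 1 / x * q ^ k ≠ 1) (k m : ℕ) : x / q ^ k * q ^ m ≠ 1 := by
  intro h
  rcases le_total k m with hkm | hkm
  · obtain ⟨l, rfl⟩ := Nat.exists_eq_add_of_le hkm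
    apply hx l
    rw [← h, pow_add]
    field_simp
  · obtain ⟨l, rfl⟩ := Nat.exists_eq_add_of_le hkm
    apply hx' l
    rw [pow_add] at h
    field_simp at h ⊢
    exact h.symm

theorem wellPoisedTerm_mul (hq0 : q ≠ 0) (hq : ‖q‖ < 1) (hx0 : x ≠ 0)
    (haq : a * q = d * e * f * x) (hx : ∀ k : ℕ, x * q ^ k ≠ 1)
    (hx' : ∀ k : ℕ, 1 / x * q ^ k ≠ 1) (hef : ∀ k : ℕ, e * f * x * q ^ k ≠ 1)
    (hdf : ∀ k : ℕ, d * f * x * q ^ k ≠ 1) (hde : ∀ k : ℕ, d * e * x * q ^ k ≠ 1) (k : ℕ) :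
    wellPoisedTerm a B γ d e f x q k *
        (qPochInf (e * f * x) q * qPochInf (d * f * x) q * qPochInf (d * e * x) q) =
      qPochInf (d * x) q * qPochInf (e * x) q * qPochInf (f * x) q / qPochInf x q *
        ∑' n, leftDouble a B γ d e f x q (k, n) +
      qPochInf d q * qPochInf e q * qPochInf f q / qPochInf (1 / x) q *
        ∑' j, rightDouble a B γ d e f x q (k, j) := by
  have hqk : q ^ k ≠ 0 := pow_ne_zero _ hq0
  have hqx := q_div_mul_pow_ne_one hx'
  have nX := qPochInf_ne_zero hq hx
  have nX' := qPochInf_ne_zero hq hx'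
  have nQX := qPoch_ne_zero hqx
  have nXQ := qPoch_ne_zero (mul_pow_ne_one_of_q_mul hx)
  have hy := div_pow_mul_pow_ne_one hq0 hx0 hx hx' k
  have hy' : ∀ m : ℕ, 1 / (x / q ^ k) * q ^ m ≠ 1 := fun m => by
    rw [show 1 / (x / q ^ k) = 1 / x * q ^ k by field_simp]
    exact mul_pow_ne_one_shift hx' k m
  -- Dividing `x` by `q ^ k` leaves `dx, ex, fx` fixed and turns the products on the right into
  -- `(efxq^k;q)_∞` and its analogues.
  have hS := saalSum_eq hq (div_ne_zero hx0 hqk) hy hy' (d * q ^ k) (e * q ^ k) (f * q ^ k)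
  have nY := qPochInf_ne_zero hq hy
  have nY' := qPochInf_ne_zero hq hy'
  have arg : ∀ u : ℂ, u * q ^ k * (x / q ^ k) = u * x := fun u => by field_simp
  have arg2 : ∀ u v : ℂ, u * q ^ k * (v * q ^ k) * (x / q ^ k) = u * v * x * q ^ k :=
    fun u v => by field_simp
  unfold saalSum at hS
  rw [arg, arg, arg, arg2, arg2, arg2] at hS
  have sp := fun u => qPoch_mul_qPochInf u q hq k
  have eL : rogersCoeff a B γ q k * (qPoch d q k * qPoch e q k * qPoch f q k) * x ^ k /
      qPochInf (x / q ^ k) q * ∑' n, saalTerm (d * q ^ k) (e * q ^ k) (f * q ^ k) (x / q ^ k) q n =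
      1 / qPochInf x q * ∑' n, leftDouble a B γ d e f x q (k, n) := by
    have h1 : qPoch (x / q ^ k) q k * qPochInf x q = qPochInf (x / q ^ k) q := by
      have := qPoch_mul_qPochInf (x / q ^ k) q hq k
      rwa [div_mul_cancel₀ _ hqk] at this
    have h2 := qPoch_div_pow_mul hq0 hx0 k
    have h3 : x ^ k / qPochInf (x / q ^ k) q =
        q ^ k * powSubProd 0 q k / (qPochInf x q * qPoch (q / x) q k) := by
      rw [div_eq_div_iff nY (mul_ne_zero nX (nQX k)), ← h1]
      linear_combination -qPochInf x q * h2
    rw [mul_div_assoc, h3, ← tsum_mul_left, ← tsum_mul_left]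
    refine tsum_congr fun n => ?_
    simp only [saalTerm, leftDouble, qPoch_add, haq]
    rw [show q / (x / q ^ k) = q / x * q ^ k by field_simp,
      show d * q ^ k * (e * q ^ k) * (f * q ^ k) * (x / q ^ k) * q ^ n =
        d * e * f * x * q ^ (k + n) * q ^ k by field_simp; ring]
    simp only [div_eq_mul_inv, mul_inv, one_mul]
    ring
  have eR : rogersCoeff a B γ q k * x ^ k / qPochInf (1 / (x / q ^ k)) q *
      ∑' n, saalTerm (d * x) (e * x) (f * x) (1 / (x / q ^ k)) q n =
      1 / qPochInf (1 / x) q * ∑' j, rightDouble a B γ d e f x q (k, j) := by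
    have h1 := sp (1 / x)
    rw [show 1 / x * q ^ k = 1 / (x / q ^ k) by field_simp] at h1
    have h3 : x ^ k / qPochInf (1 / (x / q ^ k)) q = powSubProd x q k / qPochInf (1 / x) q := by
      rw [div_eq_div_iff nY' nX', ← h1, powSubProd_eq_pow_mul hx0]
      ring
    rw [mul_div_assoc, h3, ← tsum_mul_left, ← tsum_mul_left]
    refine tsum_congr fun j => ?_
    have h4 : powSubProd x q k * (qPoch (x * q / q ^ k) q j)⁻¹ =
        powSubProd (x * q ^ j) q k * (qPoch (x * q) q j)⁻¹ := by
      rw [← div_eq_mul_inv, ← div_eq_mul_inv, div_eq_div_iff _ (nXQ j), qPoch_mul_powSubProd hq0]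
      refine qPoch_ne_zero (fun m => ?_) j
      have := hy (m + 1)
      rwa [show x * q / q ^ k * q ^ m = x / q ^ k * q ^ (m + 1) by ring]
    simp only [saalTerm, rightDouble, rogersTerm, haq]
    rw [show q / (1 / (x / q ^ k)) = x * q / q ^ k by field_simp,
      show d * x * (e * x) * (f * x) * (1 / (x / q ^ k)) * q ^ j =
        d * e * f * x * (x * q ^ j) * q ^ k by field_simp]
    simp only [div_eq_mul_inv, mul_inv, one_mul] at h4 ⊢
    linear_combination rogersCoeff a B γ q k * (qPochInf (x⁻¹) q)⁻¹ *
      (qPoch (d * x) q j * qPoch (e * x) q j * qPoch (f * x) q j *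
        qPochInf (d * e * f * x * (x * q ^ j) * q ^ k) q * (qPoch q q j)⁻¹ * q ^ j) * h4
  rw [wellPoisedTerm, ← sp (e * f * x), ← sp (d * f * x), ← sp (d * e * x)]
  have n1 := qPoch_ne_zero hef k
  have n2 := qPoch_ne_zero hdf k
  have n3 := qPoch_ne_zero hde k
  calc _ = rogersCoeff a B γ q k * (qPoch d q k * qPoch e q k * qPoch f q k) * x ^ k *
        (qPochInf (e * f * x * q ^ k) q * qPochInf (d * f * x * q ^ k) q *
          qPochInf (d * e * x * q ^ k) q) := by
        generalize qPoch (e * f * x) q k = G1 at *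
        generalize qPoch (d * f * x) q k = G2 at *
        generalize qPoch (d * e * x) q k = G3 at *
        field_simp
    _ = qPochInf (d * x) q * qPochInf (e * x) q * qPochInf (f * x) q *
        (rogersCoeff a B γ q k * (qPoch d q k * qPoch e q k * qPoch f q k) * x ^ k /
          qPochInf (x / q ^ k) q *
          ∑' n, saalTerm (d * q ^ k) (e * q ^ k) (f * q ^ k) (x / q ^ k) q n) +
        (qPoch d q k * qPochInf (d * q ^ k) q) * (qPoch e q k * qPochInf (e * q ^ k) q) *
          (qPoch f q k * qPochInf (f * q ^ k) q) *
        (rogersCoeff a B γ q k * x ^ k / qPochInf (1 / (x / q ^ k)) q *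
          ∑' n, saalTerm (d * x) (e * x) (f * x) (1 / (x / q ^ k)) q n) := by
        rw [← hS]; ring
    _ = _ := by rw [eL, eR, sp, sp, sp]; ring

theorem tsum_leftDouble (hq : ‖q‖ < 1) (ha : a ≠ 1) (hB : ∀ k : ℕ, B * q ^ k ≠ 1)
    (hγ : ∀ k : ℕ, a * q * γ * q ^ k ≠ 1) (hx : ∀ k : ℕ, q / x * q ^ k ≠ 1) :
    ∑' k, ∑' n, leftDouble a B γ d e f x q (k, n) = qPochInf (a * q) q *
      ∑' n, qPoch (B * γ) q n * qPoch d q n * qPoch e q n * qPoch f q n /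
        (qPoch q q n * qPoch B q n * qPoch (a * q * γ) q n * qPoch (q / x) q n) * q ^ n := by
  have nQ := qPoch_ne_zero (self_mul_pow_ne_one hq)
  rw [tsum_tsum_eq_tsum_sum_antidiagonal (summable_leftDouble hq hB hγ hx), ← tsum_mul_left]
  refine tsum_congr fun N => ?_
  have h1 : ∑ p ∈ Finset.HasAntidiagonal.antidiagonal N, leftDouble a B γ d e f x q p =
      qPoch d q N * qPoch e q N * qPoch f q N / (qPoch q q N * qPoch (q / x) q N) * q ^ N *
        ∑ k ∈ Finset.range (N + 1), rogersTerm a B γ q (q ^ N) k := by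
    rw [← Finset.Nat.sum_antidiagonal_eq_sum_range_succ_mk
      (fun p => rogersTerm a B γ q (q ^ N) p.1), Finset.mul_sum]
    refine Finset.sum_congr rfl fun p hp => ?_
    obtain ⟨k, n⟩ := p
    obtain rfl : k + n = N := Finset.HasAntidiagonal.mem_antidiagonal.1 hp
    have h2 : powSubProd 0 q k * (qPoch q q n)⁻¹ =
        powSubProd (q ^ (k + n)) q k * (qPoch q q (k + n))⁻¹ := by
      rw [← div_eq_mul_inv, ← div_eq_mul_inv, div_eq_div_iff (nQ _) (nQ _),
        powSubProd_zero_mul_qPoch]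
    simp only [leftDouble, rogersTerm, div_eq_mul_inv, mul_inv]
    rw [pow_add] at h2 ⊢
    linear_combination rogersCoeff a B γ q k * q ^ k * q ^ n *
      (qPoch d q (k + n) * qPoch e q (k + n) * qPoch f q (k + n) *
        qPochInf (a * q * (q ^ k * q ^ n) * q ^ k) q * (qPoch (q * x⁻¹) q (k + n))⁻¹) * h2
  have h3 : ∑ k ∈ Finset.range (N + 1), rogersTerm a B γ q (q ^ N) k =
      ∑' k, rogersTerm a B γ q (q ^ N) k := by
    refine (tsum_eq_sum fun k hk => ?_).symm
    rw [rogersTerm, powSubProd_pow_eq_zero q (by simpa using hk)]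
    ring
  rw [h1, h3, tsum_rogersTerm_pow hq ha hB hγ]
  simp only [div_eq_mul_inv, mul_inv]
  ring

theorem tsum_rightDouble (hq : ‖q‖ < 1) (ha : a ≠ 1) (hB : ∀ k : ℕ, B * q ^ k ≠ 1)
    (hγ : ∀ k : ℕ, a * q * γ * q ^ k ≠ 1) (hx : ∀ k : ℕ, x * q ^ k ≠ 1)
    (hBx : ∀ k : ℕ, B * x * q ^ k ≠ 1) (hγx : ∀ k : ℕ, a * q * γ * x * q ^ k ≠ 1)
    (hz : ‖B * γ * x‖ < 1) :
    ∑' k, ∑' j, rightDouble a B γ d e f x q (k, j) =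
      qPochInf (a * q) q * qPochInf (B * γ) q * qPochInf (B * x) q * qPochInf (a * q * γ * x) q /
        (qPochInf B q * qPochInf (a * q * γ) q * qPochInf (B * γ * x) q) *
      ∑' j, qPoch (d * x) q j * qPoch (e * x) q j * qPoch (f * x) q j * qPoch (B * γ * x) q j /
        (qPoch q q j * qPoch (B * x) q j * qPoch (a * q * γ * x) q j * qPoch (x * q) q j) *
          q ^ j := by
  refine (Summable.tsum_comm (f := fun k j => rightDouble a B γ d e f x q (k, j))
    (summable_rightDouble hq hB hγ hx hz)).symm.trans ?_
  rw [← tsum_mul_left]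
  refine tsum_congr fun j => ?_
  have hj : ‖B * γ * (x * q ^ j)‖ < 1 := by
    rw [← mul_assoc, norm_mul, norm_pow]
    exact (mul_le_of_le_one_right (norm_nonneg _) (pow_le_one₀ (norm_nonneg _) hq.le)).trans_lt hz
  have hzj := mul_pow_ne_one_of_norm_lt hq hz
  have hzj' := mul_pow_ne_one_of_norm_lt hq hj
  simp only [rightDouble]
  rw [tsum_mul_right, tsum_rogersTerm hq ha hB hγ hj, ← qPoch_mul_qPochInf (B * x) q hq j,
    ← qPoch_mul_qPochInf (a * q * γ * x) q hq j, ← qPoch_mul_qPochInf (B * γ * x) q hq j]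
  simp only [← mul_assoc] at hzj' ⊢
  have n1 := qPoch_ne_zero hBx j
  have n2 := qPoch_ne_zero hγx j
  have n3 := qPoch_ne_zero hzj j
  have n4 := qPochInf_ne_zero hq hzj'
  have n5 := qPochInf_ne_zero hq hB
  have n6 := qPochInf_ne_zero hq hγ
  have n7 := qPoch_ne_zero (self_mul_pow_ne_one hq) j
  have n8 := qPoch_ne_zero (mul_pow_ne_one_of_q_mul hx) j
  generalize qPoch (a * q * γ * x) q j = G1 at *
  generalize qPochInf (a * q * γ * x * q ^ j) q = G2 at *
  generalize qPochInf (a * q * γ) q = G3 at *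
  generalize qPoch (B * γ * x) q j = G4 at *
  generalize qPochInf (B * γ * x * q ^ j) q = G5 at *
  generalize qPoch (B * x) q j = G6 at *
  generalize qPoch (x * q) q j = G7 at *
  field_simp

/-- The three-term transformation of a very-well-poised `₈φ₇` series into two balanced `₄φ₃`
series. -/
theorem tsum_wellPoisedTerm (hq0 : q ≠ 0) (hq : ‖q‖ < 1) (hx0 : x ≠ 0) (ha : a ≠ 1)
    (haq : a * q = d * e * f * x) (hx : ∀ k : ℕ, x * q ^ k ≠ 1)
    (hx' : ∀ k : ℕ, 1 / x * q ^ k ≠ 1) (hef : ∀ k : ℕ, e * f * x * q ^ k ≠ 1)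
    (hdf : ∀ k : ℕ, d * f * x * q ^ k ≠ 1) (hde : ∀ k : ℕ, d * e * x * q ^ k ≠ 1)
    (hB : ∀ k : ℕ, B * q ^ k ≠ 1) (hγ : ∀ k : ℕ, a * q * γ * q ^ k ≠ 1)
    (hBx : ∀ k : ℕ, B * x * q ^ k ≠ 1) (hγx : ∀ k : ℕ, a * q * γ * x * q ^ k ≠ 1)
    (hz : ‖B * γ * x‖ < 1) :
    Summable (wellPoisedTerm a B γ d e f x q) ∧
    ∑' k, wellPoisedTerm a B γ d e f x q k =
      qPochInf (a * q) q * qPochInf (d * x) q * qPochInf (e * x) q * qPochInf (f * x) q /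
        (qPochInf (e * f * x) q * qPochInf (d * f * x) q * qPochInf (d * e * x) q *
          qPochInf x q) *
        ∑' n, qPoch (B * γ) q n * qPoch d q n * qPoch e q n * qPoch f q n /
          (qPoch q q n * qPoch B q n * qPoch (a * q * γ) q n * qPoch (q / x) q n) * q ^ n +
      qPochInf (a * q) q * qPochInf (B * γ) q * qPochInf d q * qPochInf e q * qPochInf f q *
          qPochInf (B * x) q * qPochInf (a * q * γ * x) q /
        (qPochInf B q * qPochInf (a * q * γ) q * qPochInf (e * f * x) q *
          qPochInf (d * f * x) q * qPochInf (d * e * x) q * qPochInf (B * γ * x) q *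
          qPochInf (1 / x) q) *
        ∑' j, qPoch (d * x) q j * qPoch (e * x) q j * qPoch (f * x) q j * qPoch (B * γ * x) q j /
          (qPoch q q j * qPoch (B * x) q j * qPoch (a * q * γ * x) q j * qPoch (x * q) q j) *
            q ^ j := by
  have hqx := q_div_mul_pow_ne_one hx'
  have hE : qPochInf (e * f * x) q * qPochInf (d * f * x) q * qPochInf (d * e * x) q ≠ 0 :=
    mul_ne_zero (mul_ne_zero (qPochInf_ne_zero hq hef) (qPochInf_ne_zero hq hdf))
      (qPochInf_ne_zero hq hde)
  have hs := ((summable_leftDouble (d := d) (e := e) (f := f) hq hB hγ hqx).prod.hasSum.mul_left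
    (qPochInf (d * x) q * qPochInf (e * x) q * qPochInf (f * x) q / qPochInf x q)).add
    ((summable_rightDouble (d := d) (e := e) (f := f) hq hB hγ hx hz).prod.hasSum.mul_left
      (qPochInf d q * qPochInf e q * qPochInf f q / qPochInf (1 / x) q))
  -- Convergence of the very-well-poised series is inherited from the two double series.
  simp only [← wellPoisedTerm_mul hq0 hq hx0 haq hx hx' hef hdf hde] at hs
  have hs := hs.mul_right
    (qPochInf (e * f * x) q * qPochInf (d * f * x) q * qPochInf (d * e * x) q)⁻¹
  simp only [mul_inv_cancel_right₀ hE] at hs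
  refine ⟨hs.summable, hs.tsum_eq.trans ?_⟩
  rw [tsum_leftDouble hq ha hB hγ hqx, tsum_rightDouble hq ha hB hγ hx hBx hγx hz]
  simp only [div_eq_mul_inv, mul_inv]
  ring

end

/-! ### Translation to basic hypergeometric notation -/

theorem qHypTerm_of_length {as bs : List ℂ} (h : as.length = bs.length + 1) (q z : ℂ) (k : ℕ) :
    qHypTerm as bs q z k = qPochList as q k / qPochList bs q k * (z ^ k / qPoch q q k) := by
  rw [qHypTerm, h]
  simp

theorem qPochList_nil (q : ℂ) (n : ℕ) : qPochList [] q n = 1 := rfl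

theorem qPochList_cons (a : ℂ) (as : List ℂ) (q : ℂ) (n : ℕ) :
    qPochList (a :: as) q n = qPoch a q n * qPochList as q n := by
  simp [qPochList]

theorem qPochInfList_nil (q : ℂ) : qPochInfList [] q = 1 := rfl

theorem qPochInfList_cons (a : ℂ) (as : List ℂ) (q : ℂ) :
    qPochInfList (a :: as) q = qPochInf a q * qPochInfList as q := by
  simp [qPochInfList]

theorem normBdd_qPochList {q : ℂ} (hq : ‖q‖ < 1) (as : List ℂ) : NormBdd (qPochList as q) := by
  induction as with
  | nil => exact .const 1
  | cons a as ih =>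
    simp only [funext (qPochList_cons a as q)]
    exact ((NormBdd.const a).qPoch hq id).mul ih

theorem normBdd_inv_qPochList {q : ℂ} (hq : ‖q‖ < 1) {bs : List ℂ}
    (h : ∀ b ∈ bs, ∀ k : ℕ, b * q ^ k ≠ 1) : NormBdd fun n => (qPochList bs q n)⁻¹ := by
  induction bs with
  | nil => simpa only [qPochList_nil] using .const _
  | cons b bs ih =>
    simp only [qPochList_cons, mul_inv]
    exact (NormBdd.inv_qPoch hq (h b (by simp)) id).mul (ih fun b hb => h b (by simp [hb]))

/-- At argument `q` the coefficients are bounded, so the geometric series dominates. -/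
theorem summable_qHypTerm_self {q : ℂ} (hq : ‖q‖ < 1) {as bs : List ℂ}
    (hl : as.length = bs.length + 1) (h : ∀ b ∈ bs, ∀ k : ℕ, b * q ^ k ≠ 1) :
    Summable (qHypTerm as bs q q) := by
  refine (((normBdd_qPochList hq as).mul (normBdd_inv_qPochList hq h)).mul
    (.inv_qPoch hq (self_mul_pow_ne_one hq) id)).summable_mul (summable_norm_pow hq) |>.congr
    fun k => ?_
  rw [qHypTerm_of_length hl, id]
  ring

theorem rogersNum_div (a q : ℂ) {b c : ℂ} (hb : b ≠ 0) (hc : c ≠ 0) (k : ℕ) :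
    rogersNum a (a * q / b) (1 / c) q k =
      (a * q / b * (1 / c)) ^ k * (qPoch b q k * qPoch c q k) := by
  induction k with
  | zero => simp [rogersNum, qPoch_zero]
  | succ k ih =>
    rw [rogersNum_succ, ih, qPoch_succ, qPoch_succ, pow_succ (_ * _), pow_succ q]
    field_simp

theorem rogersNum_zero_left (q : ℂ) (d : ℂ) {c : ℂ} (hc : c ≠ 0) (k : ℕ) :
    rogersNum 0 d (1 / c) q k = (d * (1 / c)) ^ k * qPoch c q k := by
  induction k with
  | zero => simp [rogersNum, qPoch_zero]
  | succ k ih =>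
    rw [rogersNum_succ, ih, qPoch_succ, pow_succ (_ * _)]
    field_simp
    ring

/-- Each quotient `(qs;q)_k / (s;q)_k` telescopes to `(1 - s q^k)/(1 - s)`; the factors for `s` and
`-s` combine into the very-well-poised factor. -/
theorem qPoch_sqrt_quotient {q s : ℂ} (hs : ∀ k : ℕ, s * q ^ k ≠ 1)
    (hs' : ∀ k : ℕ, -s * q ^ k ≠ 1) (k : ℕ) :
    qPoch (q * s) q k * qPoch (-(q * s)) q k / (qPoch s q k * qPoch (-s) q k) =
      (1 - s ^ 2 * q ^ (2 * k)) / (1 - s ^ 2) := by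
  have h1 := (qPoch_succ_left s q k).symm.trans (qPoch_succ s q k)
  have h2 := (qPoch_succ_left (-s) q k).symm.trans (qPoch_succ (-s) q k)
  rw [mul_comm s q] at h1
  rw [show -s * q = -(q * s) by ring] at h2
  have n1 : 1 - s ≠ 0 := sub_ne_zero.2 (by simpa using (hs 0).symm)
  have n2 : 1 - -s ≠ 0 := sub_ne_zero.2 (by simpa using (hs' 0).symm)
  have n3 : 1 - s ^ 2 ≠ 0 := by
    rw [show 1 - s ^ 2 = (1 - s) * (1 - -s) by ring]
    exact mul_ne_zero n1 n2
  rw [div_eq_div_iff (mul_ne_zero (qPoch_ne_zero hs k) (qPoch_ne_zero hs' k)) n3, mul_comm 2,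
    pow_mul]
  linear_combination (1 - -s) * qPoch (-(q * s)) q k * h1 +
    qPoch s q k * (1 - s * q ^ k) * h2

theorem threeTerm_three_phi_two {q : ℂ} (hq0 : q ≠ 0) (hq1 : ‖q‖ < 1) {a b c d e : ℂ}
    (ha : a ≠ 0) (hb : b ≠ 0) (hc : c ≠ 0) (he : e ≠ 0) (hz : ‖d * e / (a * b * c)‖ < 1)
    (h1 : ∀ k : ℕ, d * q ^ k ≠ 1) (h2 : ∀ k : ℕ, e * q ^ k ≠ 1)
    (h3 : ∀ k : ℕ, d * e / (b * c) * q ^ k ≠ 1) (h4 : ∀ k : ℕ, e / (b * c) * q ^ k ≠ 1)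
    (h5 : ∀ k : ℕ, b * c / e * q ^ k ≠ 1) :
    Summable (qHypTerm [a, b, c] [d, e] q (d * e / (a * b * c))) ∧
      qHyp [a, b, c] [d, e] q (d * e / (a * b * c)) =
        qPochInfList [e / b, e / c] q / qPochInfList [e, e / (b * c)] q *
          qHyp [d / a, b, c] [d, b * c * q / e] q q +
        qPochInfList [d / a, b, c, d * e / (b * c)] q /
            qPochInfList [d, e, b * c / e, d * e / (a * b * c)] q *
          qHyp [e / b, e / c, d * e / (a * b * c)]
            [d * e / (b * c), e * q / (b * c)] q q := by
  obtain ⟨x, hx⟩ : ∃ x, x = e / (b * c) := ⟨_, rfl⟩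
  have e1 : 1 / x = b * c / e := by rw [hx]; field_simp
  have e2 : b * c * x = e := by rw [hx]; field_simp
  have e3 : d * x = d * e / (b * c) := by rw [hx]; field_simp
  have e4 : d * (1 / a) = d / a := by ring
  have e5 : d * (1 / a) * x = d * e / (a * b * c) := by rw [hx]; field_simp
  have e10 : d / a * x = d * e / (a * b * c) := by rw [hx]; field_simp
  have e6 : q / x = b * c * q / e := by rw [hx]; field_simp
  have e7 : x * q = e * q / (b * c) := by rw [hx]; ring
  have e8 : b * x = e / c := by rw [hx]; field_simp
  have e9 : c * x = e / b := by rw [hx]; field_simp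
  have hx0 : x ≠ 0 := by rw [hx]; exact div_ne_zero he (mul_ne_zero hb hc)
  -- With `a = d = 0` the constraint `aq = defx` is void, so `x` is free, and the very-well-poised
  -- factor becomes 1.
  have T := tsum_wellPoisedTerm (q := q) (a := 0) (B := d) (γ := 1 / a) (d := 0) (e := b) (f := c)
    (x := x) hq0 hq1 hx0 zero_ne_one (by simp) (hx ▸ h4) (e1 ▸ h5) (by rwa [e2]) (by simp)
    (by simp) h1 (by simp) (by rwa [e3]) (by simp) (by rwa [e5])
  have ht : wellPoisedTerm 0 d (1 / a) 0 b c x q =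
      qHypTerm [a, b, c] [d, e] q (d * e / (a * b * c)) := by
    funext k
    rw [qHypTerm_of_length rfl, wellPoisedTerm, rogersCoeff, rogersNum_zero_left q d ha, ← e5,
      mul_pow _ x, e2]
    simp only [zero_mul, qPoch_zero_left, qPochList_cons, qPochList_nil, div_eq_mul_inv, mul_inv,
      sub_zero, inv_one, mul_one, one_mul]
    ring
  rw [ht] at T
  refine ⟨T.1, T.2.trans ?_⟩
  simp only [zero_mul, qPoch_zero_left, qPochInf_zero_left, e1, e2, e3, e4, e6, e7, e8, e9, e10, hx.symm, qHyp,
    qPochInfList_cons, qPochInfList_nil, one_mul, mul_one]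
  congr 1
  · congr 1
    · ring
    · refine tsum_congr fun k => ?_
      rw [qHypTerm_of_length rfl]
      simp only [qPochList_cons, qPochList_nil, div_eq_mul_inv, mul_inv, mul_one]
      ring
  · congr 1
    · ring
    · refine tsum_congr fun k => ?_
      rw [qHypTerm_of_length rfl]
      simp only [qPochList_cons, qPochList_nil, div_eq_mul_inv, mul_inv, mul_one]
      ring

theorem threeTerm_eight_phi_seven {q : ℂ} (hq0 : q ≠ 0) (hq1 : ‖q‖ < 1) {a s b c d e f : ℂ}
    (hs : s ^ 2 = a) (ha : a ≠ 0) (hb : b ≠ 0) (hc : c ≠ 0) (hd : d ≠ 0) (he : e ≠ 0) (hf : f ≠ 0)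
    (hz : ‖a ^ 2 * q ^ 2 / (b * c * d * e * f)‖ < 1)
    (h1 : ∀ k : ℕ, s * q ^ k ≠ 1) (h2 : ∀ k : ℕ, -s * q ^ k ≠ 1)
    (h3 : ∀ k : ℕ, a * q / b * q ^ k ≠ 1) (h4 : ∀ k : ℕ, a * q / c * q ^ k ≠ 1)
    (h5 : ∀ k : ℕ, a * q / d * q ^ k ≠ 1) (h6 : ∀ k : ℕ, a * q / e * q ^ k ≠ 1)
    (h7 : ∀ k : ℕ, a * q / f * q ^ k ≠ 1)
    (h8 : ∀ k : ℕ, a ^ 2 * q ^ 2 / (b * d * e * f) * q ^ k ≠ 1)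
    (h9 : ∀ k : ℕ, a ^ 2 * q ^ 2 / (c * d * e * f) * q ^ k ≠ 1)
    (h10 : ∀ k : ℕ, a * q / (d * e * f) * q ^ k ≠ 1)
    (h11 : ∀ k : ℕ, d * e * f / (a * q) * q ^ k ≠ 1) :
    Summable (qHypTerm [a, q * s, -(q * s), b, c, d, e, f]
        [s, -s, a * q / b, a * q / c, a * q / d, a * q / e, a * q / f] q
        (a ^ 2 * q ^ 2 / (b * c * d * e * f))) ∧
      qHyp [a, q * s, -(q * s), b, c, d, e, f]
          [s, -s, a * q / b, a * q / c, a * q / d, a * q / e, a * q / f] q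
          (a ^ 2 * q ^ 2 / (b * c * d * e * f)) =
        qPochInfList [a * q, a * q / (d * e), a * q / (d * f), a * q / (e * f)] q /
            qPochInfList [a * q / d, a * q / e, a * q / f, a * q / (d * e * f)] q *
          qHyp [a * q / (b * c), d, e, f] [a * q / b, a * q / c, d * e * f / a] q q +
        qPochInfList [a * q, a * q / (b * c), d, e, f,
              a ^ 2 * q ^ 2 / (b * d * e * f), a ^ 2 * q ^ 2 / (c * d * e * f)] q /
            qPochInfList [a * q / b, a * q / c, a * q / d, a * q / e, a * q / f,
              a ^ 2 * q ^ 2 / (b * c * d * e * f), d * e * f / (a * q)] q *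
          qHyp [a * q / (d * e), a * q / (d * f), a * q / (e * f),
              a ^ 2 * q ^ 2 / (b * c * d * e * f)]
            [a ^ 2 * q ^ 2 / (b * d * e * f), a ^ 2 * q ^ 2 / (c * d * e * f),
              a * q ^ 2 / (d * e * f)] q q := by
  obtain ⟨x, hx⟩ : ∃ x, x = a * q / (d * e * f) := ⟨_, rfl⟩
  have e1 : 1 / x = d * e * f / (a * q) := by rw [hx]; field_simp
  have e2 : e * f * x = a * q / d := by rw [hx]; field_simp
  have e3 : d * f * x = a * q / e := by rw [hx]; field_simp
  have e4 : d * e * x = a * q / f := by rw [hx]; field_simp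
  have e5 : a * q * (1 / c) = a * q / c := by ring
  have e6 : a * q / b * x = a ^ 2 * q ^ 2 / (b * d * e * f) := by rw [hx]; field_simp
  have e7 : a * q / c * x = a ^ 2 * q ^ 2 / (c * d * e * f) := by rw [hx]; field_simp
  have e8 : a * q / b * (1 / c) = a * q / (b * c) := by field_simp
  have e9 : a * q / (b * c) * x = a ^ 2 * q ^ 2 / (b * c * d * e * f) := by rw [hx]; field_simp
  have e10 : q / x = d * e * f / a := by rw [hx]; field_simp
  have e11 : x * q = a * q ^ 2 / (d * e * f) := by rw [hx]; ring
  have e12 : d * x = a * q / (e * f) := by rw [hx]; field_simp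
  have e13 : e * x = a * q / (d * f) := by rw [hx]; field_simp
  have e14 : f * x = a * q / (d * e) := by rw [hx]; field_simp
  have hx0 : x ≠ 0 := by
    rw [hx]; exact div_ne_zero (mul_ne_zero ha hq0) (mul_ne_zero (mul_ne_zero hd he) hf)
  have ha1 : a ≠ 1 := by
    -- If `a = 1` then `s = ±1`, excluded by the case `k = 0` of the conditions on `s` and `-s`.
    intro h
    rw [h, pow_two] at hs
    rcases mul_self_eq_one_iff.1 hs with h | h
    · exact h1 0 (by simp [h])
    · exact h2 0 (by simp [h])
  have T := tsum_wellPoisedTerm (q := q) (a := a) (B := a * q / b) (γ := 1 / c) (d := d) (e := e)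
    (f := f) (x := x) hq0 hq1 hx0 ha1 (by rw [hx]; field_simp) (hx ▸ h10) (e1 ▸ h11) (by rwa [e2])
    (by rwa [e3]) (by rwa [e4]) h3 (by rwa [e5]) (by rwa [e6]) (by rwa [e5, e7]) (by rwa [e8, e9])
  simp only [e5, e7, e8, e9, e1, e2, e3, e4, e6, e10, e11, e12, e13, e14] at T
  have ht : wellPoisedTerm a (a * q / b) (1 / c) d e f x q =
      qHypTerm [a, q * s, -(q * s), b, c, d, e, f]
        [s, -s, a * q / b, a * q / c, a * q / d, a * q / e, a * q / f] q
        (a ^ 2 * q ^ 2 / (b * c * d * e * f)) := by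
    funext k
    have hk := qPoch_sqrt_quotient h1 h2 k
    rw [hs] at hk
    rw [qHypTerm_of_length rfl, wellPoisedTerm, rogersCoeff, rogersNum_div a q hb hc, e2, e3, e4,
      e5, ← e9, ← e8, mul_pow _ x, mul_div_assoc (qPoch a q k), ← hk]
    simp only [qPochList_cons, qPochList_nil, div_eq_mul_inv, mul_inv, mul_one, one_mul]
    ring
  rw [ht] at T
  refine ⟨T.1, T.2.trans ?_⟩
  simp only [hx.symm, qHyp, qPochInfList_cons, qPochInfList_nil, mul_one]
  congr 1
  · congr 1
    · ring
    · refine tsum_congr fun k => ?_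
      rw [qHypTerm_of_length rfl]
      simp only [qPochList_cons, qPochList_nil, div_eq_mul_inv, mul_inv, mul_one]
      ring
  · congr 1
    · ring
    · refine tsum_congr fun k => ?_
      rw [qHypTerm_of_length rfl]
      simp only [qPochList_cons, qPochList_nil, div_eq_mul_inv, mul_inv, mul_one]
      ring

theorem mainTheorem9 (q : ℂ) (hq0 : q ≠ 0) (hq1 : ‖q‖ < 1) :
    -- the three-term transformation of a nonterminating 3φ2 series
    (∀ a b c d e : ℂ, a ≠ 0 → b ≠ 0 → c ≠ 0 → e ≠ 0 →
      ‖d * e / (a * b * c)‖ < 1 →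
      (∀ k : ℕ, d * q ^ k ≠ 1) →
      (∀ k : ℕ, e * q ^ k ≠ 1) →
      (∀ k : ℕ, d * e / (b * c) * q ^ k ≠ 1) →
      (∀ k : ℕ, e / (b * c) * q ^ k ≠ 1) →
      (∀ k : ℕ, b * c / e * q ^ k ≠ 1) →
      Summable (qHypTerm [a, b, c] [d, e] q (d * e / (a * b * c))) ∧
      Summable (qHypTerm [d / a, b, c] [d, b * c * q / e] q q) ∧
      Summable (qHypTerm [e / b, e / c, d * e / (a * b * c)]
        [d * e / (b * c), e * q / (b * c)] q q) ∧
      qHyp [a, b, c] [d, e] q (d * e / (a * b * c)) =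
        qPochInfList [e / b, e / c] q / qPochInfList [e, e / (b * c)] q *
          qHyp [d / a, b, c] [d, b * c * q / e] q q +
        qPochInfList [d / a, b, c, d * e / (b * c)] q /
            qPochInfList [d, e, b * c / e, d * e / (a * b * c)] q *
          qHyp [e / b, e / c, d * e / (a * b * c)]
            [d * e / (b * c), e * q / (b * c)] q q) ∧
    -- the three-term transformation of a very-well-poised 8φ7 series; `s` is a square root of `a`
    (∀ a s b c d e f : ℂ, s ^ 2 = a →
      a ≠ 0 → b ≠ 0 → c ≠ 0 → d ≠ 0 → e ≠ 0 → f ≠ 0 →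
      ‖a ^ 2 * q ^ 2 / (b * c * d * e * f)‖ < 1 →
      (∀ k : ℕ, s * q ^ k ≠ 1) →
      (∀ k : ℕ, -s * q ^ k ≠ 1) →
      (∀ k : ℕ, a * q / b * q ^ k ≠ 1) →
      (∀ k : ℕ, a * q / c * q ^ k ≠ 1) →
      (∀ k : ℕ, a * q / d * q ^ k ≠ 1) →
      (∀ k : ℕ, a * q / e * q ^ k ≠ 1) →
      (∀ k : ℕ, a * q / f * q ^ k ≠ 1) →
      (∀ k : ℕ, a ^ 2 * q ^ 2 / (b * d * e * f) * q ^ k ≠ 1) →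
      (∀ k : ℕ, a ^ 2 * q ^ 2 / (c * d * e * f) * q ^ k ≠ 1) →
      (∀ k : ℕ, a * q / (d * e * f) * q ^ k ≠ 1) →
      (∀ k : ℕ, d * e * f / (a * q) * q ^ k ≠ 1) →
      Summable (qHypTerm [a, q * s, -(q * s), b, c, d, e, f]
        [s, -s, a * q / b, a * q / c, a * q / d, a * q / e, a * q / f] q
        (a ^ 2 * q ^ 2 / (b * c * d * e * f))) ∧
      Summable (qHypTerm [a * q / (b * c), d, e, f]
        [a * q / b, a * q / c, d * e * f / a] q q) ∧
      Summable (qHypTerm [a * q / (d * e), a * q / (d * f), a * q / (e * f),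
          a ^ 2 * q ^ 2 / (b * c * d * e * f)]
        [a ^ 2 * q ^ 2 / (b * d * e * f), a ^ 2 * q ^ 2 / (c * d * e * f),
          a * q ^ 2 / (d * e * f)] q q) ∧
      qHyp [a, q * s, -(q * s), b, c, d, e, f]
          [s, -s, a * q / b, a * q / c, a * q / d, a * q / e, a * q / f] q
          (a ^ 2 * q ^ 2 / (b * c * d * e * f)) =
        qPochInfList [a * q, a * q / (d * e), a * q / (d * f), a * q / (e * f)] q /
            qPochInfList [a * q / d, a * q / e, a * q / f, a * q / (d * e * f)] q *
          qHyp [a * q / (b * c), d, e, f] [a * q / b, a * q / c, d * e * f / a] q q +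
        qPochInfList [a * q, a * q / (b * c), d, e, f,
              a ^ 2 * q ^ 2 / (b * d * e * f), a ^ 2 * q ^ 2 / (c * d * e * f)] q /
            qPochInfList [a * q / b, a * q / c, a * q / d, a * q / e, a * q / f,
              a ^ 2 * q ^ 2 / (b * c * d * e * f), d * e * f / (a * q)] q *
          qHyp [a * q / (d * e), a * q / (d * f), a * q / (e * f),
              a ^ 2 * q ^ 2 / (b * c * d * e * f)]
            [a ^ 2 * q ^ 2 / (b * d * e * f), a ^ 2 * q ^ 2 / (c * d * e * f),
              a * q ^ 2 / (d * e * f)] q q) := by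
  refine ⟨fun a b c d e ha hb hc he hz h1 h2 h3 h4 h5 => ?_,
    fun a s b c d e f hs ha hb hc hd he hf hz h1 h2 h3 h4 h5 h6 h7 h8 h9 h10 h11 => ?_⟩
  · have T := threeTerm_three_phi_two hq0 hq1 ha hb hc he hz h1 h2 h3 h4 h5
    refine ⟨T.1, summable_qHypTerm_self hq1 rfl ?_, summable_qHypTerm_self hq1 rfl ?_, T.2⟩
    · simp only [List.forall_mem_cons, List.not_mem_nil, false_imp_iff, implies_true, and_true]
      refine ⟨h1, fun k => ?_⟩
      rw [show b * c * q / e = b * c / e * q by ring]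
      exact mul_pow_ne_one_of_q_mul h5 k
    · simp only [List.forall_mem_cons, List.not_mem_nil, false_imp_iff, implies_true, and_true]
      refine ⟨h3, fun k => ?_⟩
      rw [show e * q / (b * c) = e / (b * c) * q by ring]
      exact mul_pow_ne_one_of_q_mul h4 k
  · have T := threeTerm_eight_phi_seven hq0 hq1 hs ha hb hc hd he hf hz h1 h2 h3 h4 h5 h6 h7 h8 h9
      h10 h11
    refine ⟨T.1, summable_qHypTerm_self hq1 rfl ?_, summable_qHypTerm_self hq1 rfl ?_, T.2⟩
    · simp only [List.forall_mem_cons, List.not_mem_nil, false_imp_iff, implies_true, and_true]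
      refine ⟨h3, h4, fun k => ?_⟩
      rw [show d * e * f / a = d * e * f / (a * q) * q by field_simp]
      exact mul_pow_ne_one_of_q_mul h11 k
    · simp only [List.forall_mem_cons, List.not_mem_nil, false_imp_iff, implies_true, and_true]
      refine ⟨h8, h9, fun k => ?_⟩
      rw [show a * q ^ 2 / (d * e * f) = a * q / (d * e * f) * q by ring]
      exact mul_pow_ne_one_of_q_mul h10 k
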